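/- Consider the planar four-body problem with positive masses $m_1,\dots,m_4$, and let $\mathcal X=\{r=(r_1,\dots,r_4)\in(\mathbb R^2)^4:\sum_k m_k r_k=0\}$. A configuration $r\in\mathcal X$ with pairwise distinct $r_k$ is a central configuration if there is $\lambda\in\mathbb R$ with $\sum_{j\ne k}\frac{m_jm_k}{|r_j-r_k|^3}(r_j-r_k)=-\lambda m_k r_k$ for all $k$. Let $\widetilde{\mathcal U}=I^{1/2}\,\mathcal U$ on $\mathcal X$, where $\mathcal U(r)=\sum_{k<j}\frac{m_km_j}{|r_k-r_j|}$ and $I(r)=\sum_k m_k|r_k|^2$. A central configuration $r$ is nondegenerate if the kernel of the Hessian of $\widetilde{\mathcal U}$ on $\mathcal X$ at $r$ is exactly $\{\rho A r:\rho>0,\ A\in SO(2)\}\cup\{0\}$, and degenerate otherwise; its degree of degeneracy is $n_0$ if that kernel has dimension $n_0+2$. A configuration is a kite if, for some line, two of the particles lie on the line and the other two are mirror images of each other in it; it is equilateral if three of the particles are the vertices of an equilateral triangle and the fourth is at its centroid. **Theorem.** If a kite central configuration of the planar four-body problem that is not equilateral is degenerate, then its degree of degeneracy is exactly one. -/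

import Mathlib

/-! Central configurations of the planar `N`-body problem. The plane `ℝ²` is identified with `ℂ`, so
that a configuration of `N` particles is a map `Fin N → ℂ`; all vector spaces are real. -/

noncomputable section

namespace NBody

variable {N : ℕ}

/-- The mass scalar product `⟨r, s⟩ = ∑ j, m j (r j, s j)`. -/
def massInner (m : Fin N → ℝ) (r s : Fin N → ℂ) : ℝ :=
  ∑ j, m j * inner ℝ (r j) (s j)

/-- The space `𝒳` of configurations whose center of mass is at the origin. -/
def centeredSpace (m : Fin N → ℝ) : Submodule ℝ (Fin N → ℂ) where
  carrier := {r | ∑ k, m k • r k = 0}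
  zero_mem' := by simp
  add_mem' := by
    intro a b ha hb
    change ∑ k, m k • a k = 0 at ha
    change ∑ k, m k • b k = 0 at hb
    change ∑ k, m k • (a k + b k) = 0
    rw [Finset.sum_congr rfl fun k _ => smul_add (m k) (a k) (b k), Finset.sum_add_distrib, ha, hb,
      add_zero]
  smul_mem' := by
    intro c a ha
    change ∑ k, m k • a k = 0 at ha
    change ∑ k, m k • (c • a k) = 0
    rw [Finset.sum_congr rfl fun k _ => smul_comm (m k) c (a k), ← Finset.smul_sum, ha, smul_zero]

/-- No two particles collide. -/
def CollisionFree (r : Fin N → ℂ) : Prop :=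
  ∀ j k, j ≠ k → r j ≠ r k

/-- A central configuration, for a configuration with center of mass at the origin. -/
def IsCentralConfiguration (m : Fin N → ℝ) (r : centeredSpace m) : Prop :=
  CollisionFree r.1 ∧ ∃ lam : ℝ, ∀ k,
    ∑ j ∈ Finset.univ.erase k, (m j * m k / ‖r.1 j - r.1 k‖ ^ 3) • (r.1 j - r.1 k)
      = -((lam * m k) • r.1 k)

/-- The force function `𝒰` (minus the potential energy). -/
def forceFunction (m : Fin N → ℝ) (r : Fin N → ℂ) : ℝ :=
  ∑ k, ∑ j ∈ Finset.Ioi k, m k * m j / ‖r k - r j‖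

/-- The center of mass. -/
def centerOfMass (m : Fin N → ℝ) (r : Fin N → ℂ) : ℂ :=
  (∑ k, m k)⁻¹ • ∑ k, m k • r k

/-- The moment of inertia `I`. -/
def momentOfInertia (m : Fin N → ℝ) (r : Fin N → ℂ) : ℝ :=
  ∑ j, m j * ‖r j - centerOfMass m r‖ ^ 2

/-- The normalized potential `I ^ (1/2) 𝒰`, as a function on `𝒳`. -/
def normalizedPotential (m : Fin N → ℝ) (r : centeredSpace m) : ℝ :=
  Real.sqrt (momentOfInertia m r.1) * forceFunction m r.1

/-- The second differential at `r` of the normalized potential on `𝒳`, a bilinear form on `𝒳`. -/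
def hessianForm (m : Fin N → ℝ) (r : centeredSpace m) :
    centeredSpace m →L[ℝ] centeredSpace m →L[ℝ] ℝ :=
  fderiv ℝ (fun x => fderiv ℝ (normalizedPotential m) x) r

/-- The kernel of the Hessian at `r` of the normalized potential on `𝒳`. For positive masses it is
the kernel of the operator which represents the second differential through the mass scalar
product: see `ker_eq_hessianKer`. -/
def hessianKer (m : Fin N → ℝ) (r : centeredSpace m) : Submodule ℝ (centeredSpace m) :=
  LinearMap.ker (hessianForm m r).toLinearMap

/-- `D²` is the operator with `d²(u, v) = ⟨D² u, v⟩`; its kernel is `hessianKer`. -/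
theorem ker_eq_hessianKer (m : Fin N → ℝ) (hm : ∀ k, 0 < m k) (r : centeredSpace m)
    (D : centeredSpace m →ₗ[ℝ] centeredSpace m)
    (hD : ∀ u v : centeredSpace m, hessianForm m r u v = massInner m (D u).1 v.1) :
    LinearMap.ker D = hessianKer m r := by
  ext u
  simp only [hessianKer, LinearMap.mem_ker, ContinuousLinearMap.coe_coe]
  constructor
  · intro h
    ext v
    simp [hD, h, massInner]
  · intro h
    have h0 : massInner m (D u).1 (D u).1 = 0 := by
      rw [← hD u (D u), h]
      rfl
    unfold massInner at h0
    rw [Finset.sum_eq_zero_iff_of_nonneg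
      (fun j _ => mul_nonneg (hm j).le real_inner_self_nonneg)] at h0
    ext j
    have hj := h0 j (Finset.mem_univ j)
    have := (mul_eq_zero.mp hj).resolve_left (hm j).ne'
    simpa using inner_self_eq_zero.mp this

/-- The plane `{ρ A r | ρ > 0, A ∈ SO(2)} ∪ {0}`: a complex number is `0` or of the form
`ρ exp (i θ)` with `ρ > 0`, and multiplication by `exp (i θ)` is the rotation by the angle `θ`. -/
def symmetryPlane (m : Fin N → ℝ) (r : centeredSpace m) : Set (centeredSpace m) :=
  {v | ∃ z : ℂ, ∀ k, v.1 k = z * r.1 k}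

/-- A central configuration is nondegenerate if the kernel of the Hessian is exactly the plane of
trivial directions. -/
def IsNondegenerate (m : Fin N → ℝ) (r : centeredSpace m) : Prop :=
  (hessianKer m r : Set (centeredSpace m)) = symmetryPlane m r

/-- The central configuration `r` has degree of degeneracy `n₀`: the nullity of the Hessian is
`n₀ + 2`. -/
def HasDegreeOfDegeneracy (m : Fin N → ℝ) (r : centeredSpace m) (n₀ : ℕ) : Prop :=
  Module.finrank ℝ (hessianKer m r) = n₀ + 2

/-- A kite: for some line (through `p` with direction `w ≠ 0`), two of the four particles lie on
the line and the other two are mirror images of each other in it. -/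
def IsKite (r : Fin 4 → ℂ) : Prop :=
  ∃ (p w : ℂ) (σ : Equiv.Perm (Fin 4)), w ≠ 0 ∧
    EuclideanGeometry.reflection (AffineSubspace.mk' p (Submodule.span ℝ {w})) (r (σ 0))
      = r (σ 1) ∧
    r (σ 2) ∈ AffineSubspace.mk' p (Submodule.span ℝ {w}) ∧
    r (σ 3) ∈ AffineSubspace.mk' p (Submodule.span ℝ {w})

/-- Three of the particles are the vertices of an equilateral triangle and the fourth one is at its
centroid. -/
def IsEquilateral (r : Fin 4 → ℂ) : Prop :=
  ∃ σ : Equiv.Perm (Fin 4),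
    dist (r (σ 0)) (r (σ 1)) = dist (r (σ 1)) (r (σ 2)) ∧
    dist (r (σ 1)) (r (σ 2)) = dist (r (σ 2)) (r (σ 0)) ∧
    r (σ 3) = (r (σ 0) + r (σ 1) + r (σ 2)) / 3

end NBody

end

noncomputable section

namespace NBody

variable {N : ℕ}

/-! At a central configuration a displacement lies in the kernel exactly when `hessVec` vanishes.
The kernel contains the plane of complex multiples of `r`, so degeneracy gives dimension at least 3.
For the upper bound, a similarity puts the kite at `i, -i, x, y` with `x > 0` and `y < x`, and
kernel vectors orthogonal to `r` satisfy translation invariant equations in the stresses `1/d³ - L`.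
The reflection splits these into an antisymmetric block in `a, p, q` and a symmetric block in `b, p,
q`. In each block `y p - x q = 0` leaves only trivial solutions: rotations in the first
(`odd_trivial`), zero in the second, where a sum of squares vanishes (`even_trivial`). So each block
contributes at most one nontrivial direction, and it remains to show that they do not both do so.

Let `u`, `v` be the distances of `x`, `y` from `±i`. A nontrivial antisymmetric solution forces `L
(y u⁵ - x v⁵) = (x - y)(2 + x y)`. For convex kites (`y < 0`) size estimates exclude this
(`not_odd_of_neg`). For concave kites symmetric degeneracy makes a `2 × 2` determinant vanish, and
eliminating `L` leaves `kitePoly = 0`. Dziobek's relation and the signs of the stresses give `u < 2`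
iff `v < x - y`, with equality only in the equilateral case, where `kitePoly` vanishes. It is
positive on the side `u < 2` (`kitePoly_pos`) and, under a bound inherited from the antisymmetric
condition, negative on the side `u > 2` (`kitePoly_neg`). For these inequalities the fifth powers
are replaced by polynomial bounds, and coordinates adapted to the region give all coefficients one
sign. -/

/-! ### Differentials of the normalized potential -/

theorem hasDerivAt_norm_line {E : Type*} [NormedAddCommGroup E] [InnerProductSpace ℝ E]
    (a b : E) (ha : a ≠ 0) :
    HasDerivAt (fun t : ℝ => ‖a + t • b‖) (inner ℝ a b / ‖a‖) 0 := by
  have h1 : HasDerivAt (fun t : ℝ => a + t • b) b 0 := by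
    simpa using ((hasDerivAt_id (0 : ℝ)).smul_const b).const_add a
  have h2 := h1.norm_sq.sqrt (by simpa using ha)
  have hn : ‖a‖ ≠ 0 := norm_ne_zero_iff.mpr ha
  convert h2 using 1
  · ext t
    rw [Real.sqrt_sq (norm_nonneg _)]
  · simp only [zero_smul, add_zero]
    rw [Real.sqrt_sq (norm_nonneg _)]
    field_simp

theorem hasDerivAt_massInner_line (m : Fin N → ℝ) (x u v : Fin N → ℂ) :
    HasDerivAt (fun t : ℝ => massInner m (x + t • u) v) (massInner m u v) 0 := by
  have h : (fun t : ℝ => massInner m (x + t • u) v)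
      = fun t => massInner m x v + t * massInner m u v := by
    ext t
    simp only [massInner, Pi.add_apply, Pi.smul_apply, inner_add_left, real_inner_smul_left,
      Finset.mul_sum, ← Finset.sum_add_distrib]
    exact Finset.sum_congr rfl fun j _ => by ring
  rw [h]
  simpa using ((hasDerivAt_id (0 : ℝ)).mul_const (massInner m u v)).const_add (massInner m x v)

theorem hasDerivAt_massInner_self_line (m : Fin N → ℝ) (x u : Fin N → ℂ) :
    HasDerivAt (fun t : ℝ => massInner m (x + t • u) (x + t • u)) (2 * massInner m x u) 0 := by
  have h : (fun t : ℝ => massInner m (x + t • u) (x + t • u))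
      = fun t => massInner m x x + t * (2 * massInner m x u) + t ^ 2 * massInner m u u := by
    ext t
    simp only [massInner, Pi.add_apply, Pi.smul_apply, inner_add_left, real_inner_smul_left,
      inner_add_right, real_inner_smul_right, Finset.mul_sum, ← Finset.sum_add_distrib]
    refine Finset.sum_congr rfl fun j _ => ?_
    rw [real_inner_comm (x j) (u j)]
    ring
  rw [h]
  have h1 := ((hasDerivAt_id (0 : ℝ)).mul_const (2 * massInner m x u)).const_add (massInner m x x)
  have h2 := ((hasDerivAt_id (0 : ℝ)).pow 2).mul_const (massInner m u u)
  exact (h1.fun_add h2).congr_deriv (by simp)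

/-- The first differential of the force function. -/
def forceDeriv (m : Fin N → ℝ) (x v : Fin N → ℂ) : ℝ :=
  ∑ k, ∑ j ∈ Finset.Ioi k, -(m k * m j * inner ℝ (x k - x j) (v k - v j) / ‖x k - x j‖ ^ 3)

/-- The second differential of the force function. -/
def forceHess (m : Fin N → ℝ) (x u v : Fin N → ℂ) : ℝ :=
  ∑ k, ∑ j ∈ Finset.Ioi k, m k * m j *
    (3 * inner ℝ (x k - x j) (u k - u j) * inner ℝ (x k - x j) (v k - v j) / ‖x k - x j‖ ^ 5
      - inner ℝ (u k - u j) (v k - v j) / ‖x k - x j‖ ^ 3)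

theorem sub_line (x u : Fin N → ℂ) (t : ℝ) (k j : Fin N) :
    (x + t • u) k - (x + t • u) j = (x k - x j) + t • (u k - u j) := by
  simp only [Pi.add_apply, Pi.smul_apply, smul_sub]
  abel

theorem hasDerivAt_forceFunction_line (m : Fin N → ℝ) (x v : Fin N → ℂ) (hx : CollisionFree x) :
    HasDerivAt (fun t : ℝ => forceFunction m (x + t • v)) (forceDeriv m x v) 0 := by
  unfold forceFunction forceDeriv
  refine HasDerivAt.fun_sum fun k _ => HasDerivAt.fun_sum fun j hj => ?_
  have hkj : x k - x j ≠ 0 := sub_ne_zero.mpr (hx k j (Finset.mem_Ioi.mp hj).ne)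
  have hn : ‖x k - x j‖ ≠ 0 := norm_ne_zero_iff.mpr hkj
  simp only [sub_line]
  have h := ((hasDerivAt_norm_line (x k - x j) (v k - v j) hkj).inv
    (by simpa using hkj)).const_mul (m k * m j)
  refine h.congr_deriv ?_
  simp only [zero_smul, add_zero]
  field_simp

theorem hasDerivAt_forceDeriv_line (m : Fin N → ℝ) (x u v : Fin N → ℂ) (hx : CollisionFree x) :
    HasDerivAt (fun t : ℝ => forceDeriv m (x + t • u) v) (forceHess m x u v) 0 := by
  unfold forceDeriv forceHess
  refine HasDerivAt.fun_sum fun k _ => HasDerivAt.fun_sum fun j hj => ?_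
  have hkj : x k - x j ≠ 0 := sub_ne_zero.mpr (hx k j (Finset.mem_Ioi.mp hj).ne)
  have hn : ‖x k - x j‖ ≠ 0 := norm_ne_zero_iff.mpr hkj
  simp only [sub_line]
  have h0 : HasDerivAt (fun t : ℝ => inner ℝ ((x k - x j) + t • (u k - u j)) (v k - v j))
      (inner ℝ (u k - u j) (v k - v j)) 0 := by
    simp only [inner_add_left, real_inner_smul_left]
    simpa using ((hasDerivAt_id (0 : ℝ)).mul_const
      (inner ℝ (u k - u j) (v k - v j))).const_add (inner ℝ (x k - x j) (v k - v j))
  have h := (((h0.const_mul (m k * m j)).div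
    ((hasDerivAt_norm_line (x k - x j) (u k - u j) hkj).pow 3) (by simpa using hkj))).neg
  refine h.congr_deriv ?_
  simp only [zero_smul, add_zero, Pi.pow_apply]
  field_simp
  push_cast
  ring

theorem massInner_self_pos (m : Fin N → ℝ) (hm : ∀ k, 0 < m k) {x : Fin N → ℂ} (hx : x ≠ 0) :
    0 < massInner m x x := by
  obtain ⟨k, hk⟩ := Function.ne_iff.mp hx
  refine Finset.sum_pos' (fun j _ => mul_nonneg (hm j).le real_inner_self_nonneg)
    ⟨k, Finset.mem_univ k, mul_pos (hm k) (real_inner_self_pos.mpr hk)⟩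

theorem normalizedPotential_eq (m : Fin N → ℝ) (x : centeredSpace m) :
    normalizedPotential m x = Real.sqrt (massInner m x.1 x.1) * forceFunction m x.1 := by
  have hx : ∑ k, m k • x.1 k = 0 := x.2
  simp only [normalizedPotential, momentOfInertia, massInner, centerOfMass, hx, smul_zero, sub_zero,
    real_inner_self_eq_norm_sq]

/-- The first differential of the normalized potential. -/
def potentialDeriv (m : Fin N → ℝ) (x v : Fin N → ℂ) : ℝ :=
  massInner m x v / Real.sqrt (massInner m x x) * forceFunction m x
    + Real.sqrt (massInner m x x) * forceDeriv m x v

theorem hasDerivAt_normalizedPotential_line (m : Fin N → ℝ) (hm : ∀ k, 0 < m k)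
    (x v : centeredSpace m) (hx : CollisionFree x.1) (h0 : x.1 ≠ 0) :
    HasDerivAt (fun t : ℝ => normalizedPotential m (x + t • v)) (potentialDeriv m x.1 v.1) 0 := by
  have hI := massInner_self_pos m hm h0
  have h1 := ((hasDerivAt_massInner_self_line m x.1 v.1).sqrt (by simpa using hI.ne')).mul
    (hasDerivAt_forceFunction_line m x.1 v.1 hx)
  have he : (fun t : ℝ => normalizedPotential m (x + t • v)) = fun t : ℝ =>
      Real.sqrt (massInner m (x.1 + t • v.1) (x.1 + t • v.1)) * forceFunction m (x.1 + t • v.1) := by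
    ext t
    rw [normalizedPotential_eq]
    rfl
  rw [he]
  refine h1.congr_deriv ?_
  have hs := (Real.sqrt_pos.mpr hI).ne'
  simp only [zero_smul, add_zero, potentialDeriv]
  field_simp

theorem hasDerivAt_potentialDeriv_line (m : Fin N → ℝ) (hm : ∀ k, 0 < m k)
    (x u v : Fin N → ℂ) (hx : CollisionFree x) (h0 : x ≠ 0) :
    HasDerivAt (fun t : ℝ => potentialDeriv m (x + t • u) v)
      ((massInner m u v * forceFunction m x + massInner m x v * forceDeriv m x u
        + massInner m x u * forceDeriv m x v
        - massInner m x u * massInner m x v * forceFunction m x / massInner m x x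
        + massInner m x x * forceHess m x u v) / Real.sqrt (massInner m x x)) 0 := by
  have hI := massInner_self_pos m hm h0
  have hs := (Real.sqrt_pos.mpr hI).ne'
  have hsq := (hasDerivAt_massInner_self_line m x u).sqrt (by simpa using hI.ne')
  have h := (((hasDerivAt_massInner_line m x u v).div hsq (by simpa using hs)).mul
    (hasDerivAt_forceFunction_line m x u hx)).add (hsq.mul (hasDerivAt_forceDeriv_line m x u v hx))
  refine h.congr_deriv ?_
  simp only [zero_smul, add_zero, Pi.div_apply]
  have h2 : massInner m x x = Real.sqrt (massInner m x x) ^ 2 := (Real.sq_sqrt hI.le).symm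
  generalize hS : Real.sqrt (massInner m x x) = S at *
  rw [h2]
  field_simp
  ring

theorem isOpen_collisionFree : IsOpen {x : Fin N → ℂ | CollisionFree x} := by
  simp only [CollisionFree, Set.ofPred_forall]
  refine isOpen_iInter_of_finite fun j => isOpen_iInter_of_finite fun k =>
    isOpen_iInter_of_finite fun _ => ?_
  exact isOpen_ne_fun (continuous_apply j) (continuous_apply k)

theorem contDiffAt_normalizedPotential (m : Fin N → ℝ) (hm : ∀ k, 0 < m k)
    (x : centeredSpace m) (hx : CollisionFree x.1) (h0 : x.1 ≠ 0) :
    ContDiffAt ℝ 2 (normalizedPotential m) x := by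
  have hp : ∀ k, ContDiffAt ℝ 2 (fun y : centeredSpace m => y.1 k) x := fun k =>
    ((ContinuousLinearMap.proj (R := ℝ) (φ := fun _ : Fin N => ℂ) k).comp
      (centeredSpace m).subtypeL).contDiff.contDiffAt
  have he : normalizedPotential m = fun y : centeredSpace m =>
      Real.sqrt (massInner m y.1 y.1) * forceFunction m y.1 := funext (normalizedPotential_eq m)
  rw [he]
  refine ContDiffAt.mul (ContDiffAt.sqrt ?_ (massInner_self_pos m hm h0).ne') ?_
  · unfold massInner
    exact ContDiffAt.sum fun k _ => contDiffAt_const.mul ((hp k).inner ℝ (hp k))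
  · unfold forceFunction
    refine ContDiffAt.sum fun k _ => ContDiffAt.sum fun j hj => ?_
    have hkj : x.1 k - x.1 j ≠ 0 := sub_ne_zero.mpr (hx k j (Finset.mem_Ioi.mp hj).ne)
    exact contDiffAt_const.div (((hp k).sub (hp j)).norm ℝ hkj) (norm_ne_zero_iff.mpr hkj)

theorem hessianForm_apply (m : Fin N → ℝ) (hm : ∀ k, 0 < m k)
    (x u v : centeredSpace m) (hx : CollisionFree x.1) (h0 : x.1 ≠ 0) :
    hessianForm m x u v =
      (massInner m u.1 v.1 * forceFunction m x.1 + massInner m x.1 v.1 * forceDeriv m x.1 u.1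
        + massInner m x.1 u.1 * forceDeriv m x.1 v.1
        - massInner m x.1 u.1 * massInner m x.1 v.1 * forceFunction m x.1 / massInner m x.1 x.1
        + massInner m x.1 x.1 * forceHess m x.1 u.1 v.1) / Real.sqrt (massInner m x.1 x.1) := by
  have hC := contDiffAt_normalizedPotential m hm x hx h0
  have hD : DifferentiableAt ℝ (fderiv ℝ (normalizedPotential m)) x :=
    (hC.fderiv_right (m := 1) (by norm_num)).differentiableAt (by norm_num)
  have h1 : hessianForm m x u v
      = fderiv ℝ (fun y => fderiv ℝ (normalizedPotential m) y v) x u := by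
    rw [fderiv_clm_apply hD (differentiableAt_const v)]
    simp [hessianForm]
  have hdv : DifferentiableAt ℝ (fun y => fderiv ℝ (normalizedPotential m) y v) x :=
    hD.clm_apply (differentiableAt_const v)
  -- Being collision free and nonzero are open conditions, so the closed formula for the first
  -- differential holds near `x` and can be differentiated once more along a line.
  have hev : ∀ᶠ y in nhds x, fderiv ℝ (normalizedPotential m) y v = potentialDeriv m y.1 v.1 := by
    have hopen : IsOpen {y : centeredSpace m | CollisionFree y.1 ∧ y.1 ≠ 0} :=
      (isOpen_collisionFree.preimage continuous_subtype_val).inter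
        (isOpen_ne.preimage continuous_subtype_val)
    filter_upwards [hopen.mem_nhds ⟨hx, h0⟩] with y hy
    have hd := (contDiffAt_normalizedPotential m hm y hy.1 hy.2).differentiableAt (by norm_num)
    rw [← hd.lineDeriv_eq_fderiv]
    exact (hasDerivAt_normalizedPotential_line m hm y v hy.1 hy.2).deriv
  rw [h1, ← hdv.lineDeriv_eq_fderiv, Filter.EventuallyEq.lineDeriv_eq hev]
  exact (hasDerivAt_potentialDeriv_line m hm x.1 u.1 v.1 hx h0).deriv

/-! ### The kernel of the Hessian at a central configuration -/

/-- Action equals reaction: for antisymmetric pair forces, the work over pairs regroups as the work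
of the total force on each particle. -/
theorem sum_sum_Ioi_inner_sub {E : Type*} [NormedAddCommGroup E] [InnerProductSpace ℝ E]
    (F : Fin N → Fin N → E) (hF : ∀ k j, F j k = -F k j) (v : Fin N → E) :
    ∑ k, ∑ j ∈ Finset.Ioi k, inner ℝ (F k j) (v k - v j)
      = ∑ k, inner ℝ (∑ j ∈ Finset.univ.erase k, F k j) (v k) := by
  have h := Finset.sum_sum_Ioi_add_eq_sum_sum_off_diag (fun j k => inner ℝ (F k j) (v k))
  simp only [Finset.compl_singleton] at h
  simp only [sum_inner]
  rw [← h]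
  refine Finset.sum_congr rfl fun k _ => Finset.sum_congr rfl fun j _ => ?_
  rw [hF k j, inner_sub_right, inner_neg_left]
  ring

/-- The central configuration equations with multiplier `lam`. -/
def IsCentralWith (m : Fin N → ℝ) (lam : ℝ) (x : Fin N → ℂ) : Prop :=
  ∀ k, ∑ j ∈ Finset.univ.erase k, (m j * m k / ‖x j - x k‖ ^ 3) • (x j - x k)
    = -((lam * m k) • x k)

theorem IsCentralWith.forceDeriv_eq {m : Fin N → ℝ} {lam : ℝ} {x : Fin N → ℂ}
    (h : IsCentralWith m lam x) (v : Fin N → ℂ) :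
    forceDeriv m x v = -(lam * massInner m x v) := by
  have h1 := sum_sum_Ioi_inner_sub
    (fun k j => (m j * m k / ‖x j - x k‖ ^ 3) • (x j - x k)) (fun k j => by
      rw [norm_sub_rev (x j) (x k), ← smul_neg, neg_sub, mul_comm (m j)]) v
  simp only [h _] at h1
  have h2 : forceDeriv m x v = ∑ k, ∑ j ∈ Finset.Ioi k,
      inner ℝ ((m j * m k / ‖x j - x k‖ ^ 3) • (x j - x k)) (v k - v j) := by
    unfold forceDeriv
    refine Finset.sum_congr rfl fun k _ => Finset.sum_congr rfl fun j _ => ?_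
    rw [real_inner_smul_left, norm_sub_rev (x j), ← neg_sub (x k) (x j), inner_neg_left]
    ring
  rw [h2, h1, massInner, Finset.mul_sum, ← Finset.sum_neg_distrib]
  refine Finset.sum_congr rfl fun k _ => ?_
  rw [inner_neg_left, real_inner_smul_left]
  ring

theorem forceDeriv_self (m : Fin N → ℝ) (x : Fin N → ℂ) (hx : CollisionFree x) :
    forceDeriv m x x = -forceFunction m x := by
  unfold forceDeriv forceFunction
  rw [← Finset.sum_neg_distrib]
  refine Finset.sum_congr rfl fun k _ => ?_
  rw [← Finset.sum_neg_distrib]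
  refine Finset.sum_congr rfl fun j hj => ?_
  have hn : ‖x k - x j‖ ≠ 0 :=
    norm_ne_zero_iff.mpr (sub_ne_zero.mpr (hx k j (Finset.mem_Ioi.mp hj).ne))
  rw [real_inner_self_eq_norm_sq]
  field_simp

/-- The vector which represents the second differential of the force function. -/
def forceHessVec (m : Fin N → ℝ) (x u : Fin N → ℂ) (k : Fin N) : ℂ :=
  ∑ j ∈ Finset.univ.erase k, (m j * m k) •
    ((3 * inner ℝ (x k - x j) (u k - u j) / ‖x k - x j‖ ^ 5) • (x k - x j)
      - (1 / ‖x k - x j‖ ^ 3) • (u k - u j))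

theorem forceHess_pair_antisymm (m : Fin N → ℝ) (x u : Fin N → ℂ) (k j : Fin N) :
    (m k * m j) • ((3 * inner ℝ (x j - x k) (u j - u k) / ‖x j - x k‖ ^ 5) • (x j - x k)
      - (1 / ‖x j - x k‖ ^ 3) • (u j - u k))
    = -((m j * m k) • ((3 * inner ℝ (x k - x j) (u k - u j) / ‖x k - x j‖ ^ 5) • (x k - x j)
      - (1 / ‖x k - x j‖ ^ 3) • (u k - u j))) := by
  rw [norm_sub_rev (x j), ← neg_sub (x k) (x j), ← neg_sub (u k) (u j), inner_neg_neg]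
  module

theorem forceHess_eq (m : Fin N → ℝ) (x u v : Fin N → ℂ) :
    forceHess m x u v = ∑ k, inner ℝ (forceHessVec m x u k) (v k) := by
  unfold forceHessVec
  rw [← sum_sum_Ioi_inner_sub _ (forceHess_pair_antisymm m x u), forceHess]
  refine Finset.sum_congr rfl fun k _ => Finset.sum_congr rfl fun j _ => ?_
  rw [real_inner_smul_left, inner_sub_left (_ • _), real_inner_smul_left, real_inner_smul_left]
  ring

theorem sum_forceHessVec (m : Fin N → ℝ) (x u : Fin N → ℂ) : ∑ k, forceHessVec m x u k = 0 := by
  have h := sum_sum_Ioi_inner_sub _ (forceHess_pair_antisymm m x u)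
    (fun _ => ∑ k, forceHessVec m x u k)
  simp only [sub_self, inner_zero_right, Finset.sum_const_zero] at h
  rw [← sum_inner] at h
  exact inner_self_eq_zero.mp h.symm

/-- The vector which represents the second differential of the normalized potential at a central
configuration, up to a positive factor. -/
def hessVec (m : Fin N → ℝ) (lam : ℝ) (x u : Fin N → ℂ) (k : Fin N) : ℂ :=
  forceHessVec m x u k + (lam * m k) • u k
    - (3 * lam * massInner m x u / massInner m x x * m k) • x k

theorem IsCentralWith.hessianForm_eq {m : Fin N → ℝ} (hm : ∀ k, 0 < m k) {lam : ℝ}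
    {x : centeredSpace m} (h : IsCentralWith m lam x.1) (hx : CollisionFree x.1) (h0 : x.1 ≠ 0)
    (u v : centeredSpace m) :
    hessianForm m x u v =
      Real.sqrt (massInner m x.1 x.1) * ∑ k, inner ℝ (hessVec m lam x.1 u.1 k) (v.1 k) := by
  have hI := massInner_self_pos m hm h0
  have hs := (Real.sqrt_pos.mpr hI).ne'
  -- Euler's identity in degree `-1`, combined with the central configuration equations.
  have hU : forceFunction m x.1 = lam * massInner m x.1 x.1 := by
    have := forceDeriv_self m x.1 hx
    rw [h.forceDeriv_eq] at this
    linarith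
  have hsum : ∑ k, inner ℝ (hessVec m lam x.1 u.1 k) (v.1 k) = forceHess m x.1 u.1 v.1
      + lam * massInner m u.1 v.1
      - 3 * lam * massInner m x.1 u.1 / massInner m x.1 x.1 * massInner m x.1 v.1 := by
    rw [forceHess_eq]
    conv_rhs => rw [massInner.eq_def m u.1 v.1, massInner.eq_def m x.1 v.1]
    rw [Finset.mul_sum, Finset.mul_sum, ← Finset.sum_add_distrib, ← Finset.sum_sub_distrib]
    refine Finset.sum_congr rfl fun k _ => ?_
    rw [hessVec, inner_sub_left, inner_add_left, real_inner_smul_left, real_inner_smul_left]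
    ring
  rw [hessianForm_apply m hm x u v hx h0, hsum, h.forceDeriv_eq, h.forceDeriv_eq, hU]
  have h2 : massInner m x.1 x.1 = Real.sqrt (massInner m x.1 x.1) ^ 2 := (Real.sq_sqrt hI.le).symm
  generalize hS : Real.sqrt (massInner m x.1 x.1) = S at *
  rw [h2]
  field_simp
  ring

theorem sum_mass_smul_eq_zero {m : Fin N → ℝ} (u : centeredSpace m) : ∑ k, m k • u.1 k = 0 := u.2

theorem sum_hessVec (m : Fin N → ℝ) (lam : ℝ) (x u : centeredSpace m) :
    ∑ k, hessVec m lam x.1 u.1 k = 0 := by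
  simp only [hessVec, Finset.sum_sub_distrib, Finset.sum_add_distrib, sum_forceHessVec, mul_smul,
    ← Finset.smul_sum, sum_mass_smul_eq_zero, smul_zero, add_zero, sub_zero]

theorem IsCentralWith.mem_hessianKer_iff {m : Fin N → ℝ} (hm : ∀ k, 0 < m k) {lam : ℝ}
    {x : centeredSpace m} (h : IsCentralWith m lam x.1) (hx : CollisionFree x.1) (h0 : x.1 ≠ 0)
    (u : centeredSpace m) :
    u ∈ hessianKer m x ↔ ∀ k, hessVec m lam x.1 u.1 k = 0 := by
  have hs := (Real.sqrt_pos.mpr (massInner_self_pos m hm h0)).ne'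
  rw [hessianKer, LinearMap.mem_ker]
  constructor
  · intro hu
    obtain ⟨i, -⟩ := Function.ne_iff.mp h0
    have hM : ∑ k, m k ≠ 0 := (Finset.sum_pos (fun k _ => hm k) ⟨i, Finset.mem_univ i⟩).ne'
    set w := hessVec m lam x.1 u.1 with hw
    -- Only centered test vectors are available. Subtracting the center of mass costs nothing, since
    -- `w` has zero sum and is orthogonal to constants.
    let v : centeredSpace m := ⟨fun k => w k - centerOfMass m w, by
      change ∑ k, m k • (w k - centerOfMass m w) = 0
      simp only [smul_sub, Finset.sum_sub_distrib, ← Finset.sum_smul]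
      rw [centerOfMass, smul_smul, mul_inv_cancel₀ hM, one_smul, sub_self]⟩
    have h1 : hessianForm m x u v = 0 := by
      have : (hessianForm m x u) = 0 := hu
      rw [this]
      rfl
    rw [h.hessianForm_eq hm hx h0, mul_eq_zero, or_iff_right hs] at h1
    have h2 : ∑ k, inner ℝ (w k) (v.1 k) = ∑ k, inner ℝ (w k) (w k) := by
      change ∑ k, inner ℝ (w k) (w k - centerOfMass m w) = _
      simp only [inner_sub_right, Finset.sum_sub_distrib]
      rw [← sum_inner, hw, sum_hessVec, inner_zero_left, sub_zero]
    rw [h2, Finset.sum_eq_zero_iff_of_nonneg fun k _ => real_inner_self_nonneg] at h1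
    exact fun k => inner_self_eq_zero.mp (h1 k (Finset.mem_univ k))
  · intro hu
    change hessianForm m x u = 0
    ext v
    rw [h.hessianForm_eq hm hx h0]
    simp [hu]

theorem IsCentralWith.sum_eq {m : Fin N → ℝ} {lam : ℝ} {x : Fin N → ℂ}
    (h : IsCentralWith m lam x) (k : Fin N) :
    ∑ j ∈ Finset.univ.erase k, (m j * m k) • ((1 / ‖x k - x j‖ ^ 3) • (x k - x j))
      = (lam * m k) • x k := by
  rw [← neg_inj, ← h k, ← Finset.sum_neg_distrib]
  refine Finset.sum_congr rfl fun j _ => ?_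
  rw [norm_sub_rev (x k), ← neg_sub (x j) (x k)]
  module

/-- The force part contributes `3 Re z - z` times `lam m x`; the last two terms of `hessVec`
contribute `z - 3 Re z` times the same vector. -/
theorem IsCentralWith.hessVec_mul_eq_zero {m : Fin N → ℝ} (hm : ∀ k, 0 < m k) {lam : ℝ}
    {x : Fin N → ℂ} (h : IsCentralWith m lam x) (hx : CollisionFree x) (h0 : x ≠ 0)
    (z : ℂ) (k : Fin N) : hessVec m lam x (fun j => z * x j) k = 0 := by
  have hI := (massInner_self_pos m hm h0).ne'
  have hin : ∀ a : ℂ, inner ℝ a (z * a) = z.re * ‖a‖ ^ 2 := by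
    intro a
    rw [Complex.inner, ← Complex.normSq_eq_norm_sq, Complex.normSq_apply]
    simp
    ring
  have h1 : massInner m x (fun j => z * x j) = z.re * massInner m x x := by
    simp only [massInner, hin, real_inner_self_eq_norm_sq, Finset.mul_sum]
    exact Finset.sum_congr rfl fun j _ => by ring
  have h2 : forceHessVec m x (fun j => z * x j) k = (3 * z.re - z) * ((lam * m k) • x k) := by
    rw [← h.sum_eq k, forceHessVec, Finset.mul_sum]
    refine Finset.sum_congr rfl fun j hj => ?_
    have hn : ‖x k - x j‖ ≠ 0 :=
      norm_ne_zero_iff.mpr (sub_ne_zero.mpr (hx k j (Finset.ne_of_mem_erase hj).symm))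
    rw [← mul_sub, hin]
    have : 3 * (z.re * ‖x k - x j‖ ^ 2) / ‖x k - x j‖ ^ 5 = 3 * z.re * (1 / ‖x k - x j‖ ^ 3) := by
      field_simp
    rw [this]
    simp only [Complex.real_smul]
    push_cast
    ring
  rw [hessVec, h1, h2]
  have : 3 * lam * (z.re * massInner m x x) / massInner m x x = 3 * lam * z.re := by
    field_simp
  rw [this]
  simp only [Complex.real_smul]
  push_cast
  ring

/-- The plane of trivial directions as a subspace. -/
def rotationSpace (m : Fin N → ℝ) (x : centeredSpace m) : Submodule ℝ (centeredSpace m) :=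
  LinearMap.range (LinearMap.codRestrict (centeredSpace m)
    (LinearMap.pi fun k => LinearMap.mulRight ℝ (x.1 k)) fun z => by
      change ∑ k, m k • (z * x.1 k) = 0
      simp only [← mul_smul_comm, ← Finset.mul_sum, sum_mass_smul_eq_zero, mul_zero])

theorem mem_rotationSpace_iff (m : Fin N → ℝ) (x v : centeredSpace m) :
    v ∈ rotationSpace m x ↔ ∃ z : ℂ, ∀ k, v.1 k = z * x.1 k := by
  rw [rotationSpace, LinearMap.mem_range]
  refine exists_congr fun z => ?_
  rw [Subtype.ext_iff, funext_iff]
  exact forall_congr' fun k => eq_comm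

theorem finrank_rotationSpace (m : Fin N → ℝ) (x : centeredSpace m) (h0 : x.1 ≠ 0) :
    Module.finrank ℝ (rotationSpace m x) = 2 := by
  rw [rotationSpace, LinearMap.finrank_range_of_inj, Complex.finrank_real_complex]
  intro z w hzw
  obtain ⟨i, hi⟩ := Function.ne_iff.mp h0
  exact mul_right_cancel₀ hi (congrFun (Subtype.ext_iff.mp hzw) i)

theorem IsCentralWith.rotationSpace_le {m : Fin N → ℝ} (hm : ∀ k, 0 < m k) {lam : ℝ}
    {x : centeredSpace m} (h : IsCentralWith m lam x.1) (hx : CollisionFree x.1) (h0 : x.1 ≠ 0) :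
    rotationSpace m x ≤ hessianKer m x := by
  intro v hv
  obtain ⟨z, hz⟩ := (mem_rotationSpace_iff m x v).mp hv
  rw [h.mem_hessianKer_iff hm hx h0, (funext hz : v.1 = fun k => z * x.1 k)]
  exact h.hessVec_mul_eq_zero hm hx h0 z

theorem IsCentralWith.three_le_finrank {m : Fin N → ℝ} (hm : ∀ k, 0 < m k) {lam : ℝ}
    {x : centeredSpace m} (h : IsCentralWith m lam x.1) (hx : CollisionFree x.1) (h0 : x.1 ≠ 0)
    (hdeg : ¬ IsNondegenerate m x) : 3 ≤ Module.finrank ℝ (hessianKer m x) := by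
  have hle := h.rotationSpace_le hm hx h0
  have hne : rotationSpace m x ≠ hessianKer m x := by
    intro he
    apply hdeg
    rw [IsNondegenerate, ← he]
    ext v
    exact mem_rotationSpace_iff m x v
  have := Submodule.finrank_lt_finrank_of_lt (lt_of_le_of_ne hle hne)
  rw [finrank_rotationSpace m x h0] at this
  exact this

/-! ### Polynomial inequalities for concave kites -/

/-- The part of `kitePoly` (in rescaled, homogenized variables) which is free of `√3`. -/
def kiteRat (o a b U V : ℝ) : ℝ :=
  (3 * a - b) * (2 * o ^ 2 + a * b) *
      (8 * a * U * o ^ 5 + a ^ 3 * V * ((3 * a - b) ^ 3 / 3) * o ^ 2)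
    - (o ^ 2 + 2 * (a * b)) * ((b ^ 2 * U ^ 2 * o + 3 * a ^ 2 * V ^ 2 * o ^ 5) / 3
      + (3 * a - b) * (8 * b * U * o ^ 5
        + a * (a * b) * V * ((3 * a - b) ^ 3 / 3) * o ^ 2) / 3)

/-- The coefficient of `√3` in `kitePoly` (in rescaled, homogenized variables). -/
def kiteIrr (o a b U V : ℝ) : ℝ :=
  -((2 * o ^ 2 + a * b) * ((3 * a - b) * b ^ 3 * U * ((3 * a - b) ^ 3 / 3) / 9
      + 8 * b * V * (3 * a - b) * o ^ 7 / 3 + (3 * a - b) ^ 2 * U * V * o ^ 3 / 3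
      + (3 * a - b) ^ 2 * (3 * a + b) ^ 2 * 8 * ((3 * a - b) ^ 3 / 3) * o ^ 4 / 9) / 3)
    + (o ^ 2 + 2 * (a * b)) * (2 * a * b * U * V * o ^ 3 / 3
      + (3 * a - b) * (8 * a * V * o ^ 7
        + b * U * (a * b) * ((3 * a - b) ^ 3 / 3) / 3) / 3)

/-- A homogenized upper bound of `(1 + 3 a²) ^ (5/2)` for `a ≤ 1`. -/
def innerHi (o a : ℝ) : ℝ := 8 * (o ^ 2 + 3 * a ^ 2) * o ^ 2

/-- A homogenized lower bound of `(1 + 3 a²) ^ (5/2)`. -/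
def innerLo (o a : ℝ) : ℝ := 3 * (o ^ 2 + 3 * a ^ 2) ^ 2 - 4 * (o ^ 2 + 3 * a ^ 2) * o ^ 2

/-- Here `o = b + 2e + d` stands for 1 and `a = b + e + d`, so `b, e, d` are coordinates on the
triangle `b > 0`, `a < 1`, `b ≤ 2a - 1`. The expansion has no negative coefficient, hence
`positivity`. The eight lemmas of this kind cover the four corners of the box for `(U, V)`, each
with the factor 0 or 2 in place of `√3`. -/
theorem kiteRat_pos_hi_lo {b e d : ℝ} (hb : 0 < b) (he : 0 < e) (hd : 0 ≤ d) :
    0 < kiteRat (b + 2 * e + d) (b + e + d) b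
      (innerHi (b + 2 * e + d) (b + e + d)) ((12 * (b + 2 * e + d) ^ 2 + 20 * b ^ 2) / 9) := by
  unfold kiteRat innerHi
  ring_nf
  positivity

theorem kiteRat_add_pos_hi_lo {b e d : ℝ} (hb : 0 < b) (he : 0 < e) (hd : 0 ≤ d) :
    0 < kiteRat (b + 2 * e + d) (b + e + d) b
      (innerHi (b + 2 * e + d) (b + e + d)) ((12 * (b + 2 * e + d) ^ 2 + 20 * b ^ 2) / 9)
    + 2 * kiteIrr (b + 2 * e + d) (b + e + d) b
      (innerHi (b + 2 * e + d) (b + e + d)) ((12 * (b + 2 * e + d) ^ 2 + 20 * b ^ 2) / 9) := by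
  unfold kiteRat kiteIrr innerHi
  ring_nf
  positivity

theorem kiteRat_pos_hi_hi {b e d : ℝ} (hb : 0 < b) (he : 0 < e) (hd : 0 ≤ d) :
    0 < kiteRat (b + 2 * e + d) (b + e + d) b
      (innerHi (b + 2 * e + d) (b + e + d)) ((63 * (b + 2 * e + d) ^ 2 + 65 * b ^ 2) / 36) := by
  unfold kiteRat innerHi
  ring_nf
  positivity

theorem kiteRat_add_pos_hi_hi {b e d : ℝ} (hb : 0 < b) (he : 0 < e) (hd : 0 ≤ d) :
    0 < kiteRat (b + 2 * e + d) (b + e + d) b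
      (innerHi (b + 2 * e + d) (b + e + d)) ((63 * (b + 2 * e + d) ^ 2 + 65 * b ^ 2) / 36)
    + 2 * kiteIrr (b + 2 * e + d) (b + e + d) b
      (innerHi (b + 2 * e + d) (b + e + d)) ((63 * (b + 2 * e + d) ^ 2 + 65 * b ^ 2) / 36) := by
  unfold kiteRat kiteIrr innerHi
  ring_nf
  positivity

theorem kiteRat_pos_lo_lo {b e d : ℝ} (hb : 0 < b) (he : 0 < e) (hd : 0 ≤ d) :
    0 < kiteRat (b + 2 * e + d) (b + e + d) b
      (innerLo (b + 2 * e + d) (b + e + d)) ((12 * (b + 2 * e + d) ^ 2 + 20 * b ^ 2) / 9) := by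
  unfold kiteRat innerLo
  ring_nf
  positivity

theorem kiteRat_add_pos_lo_lo {b e d : ℝ} (hb : 0 < b) (he : 0 < e) (hd : 0 ≤ d) :
    0 < kiteRat (b + 2 * e + d) (b + e + d) b
      (innerLo (b + 2 * e + d) (b + e + d)) ((12 * (b + 2 * e + d) ^ 2 + 20 * b ^ 2) / 9)
    + 2 * kiteIrr (b + 2 * e + d) (b + e + d) b
      (innerLo (b + 2 * e + d) (b + e + d)) ((12 * (b + 2 * e + d) ^ 2 + 20 * b ^ 2) / 9) := by
  unfold kiteRat kiteIrr innerLo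
  ring_nf
  positivity

theorem kiteRat_pos_lo_hi {b e d : ℝ} (hb : 0 < b) (he : 0 < e) (hd : 0 ≤ d) :
    0 < kiteRat (b + 2 * e + d) (b + e + d) b
      (innerLo (b + 2 * e + d) (b + e + d)) ((63 * (b + 2 * e + d) ^ 2 + 65 * b ^ 2) / 36) := by
  unfold kiteRat innerLo
  ring_nf
  positivity

theorem kiteRat_add_pos_lo_hi {b e d : ℝ} (hb : 0 < b) (he : 0 < e) (hd : 0 ≤ d) :
    0 < kiteRat (b + 2 * e + d) (b + e + d) b
      (innerLo (b + 2 * e + d) (b + e + d)) ((63 * (b + 2 * e + d) ^ 2 + 65 * b ^ 2) / 36)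
    + 2 * kiteIrr (b + 2 * e + d) (b + e + d) b
      (innerLo (b + 2 * e + d) (b + e + d)) ((63 * (b + 2 * e + d) ^ 2 + 65 * b ^ 2) / 36) := by
  unfold kiteRat kiteIrr innerLo
  ring_nf
  positivity

/-- The derivative of `kiteRat` in `U`. -/
def kiteRatU (o a b U : ℝ) : ℝ :=
  (3 * a - b) * (2 * o ^ 2 + a * b) * (8 * a) * o ^ 5
    - (o ^ 2 + 2 * (a * b)) * (2 * b ^ 2 * U * o + (3 * a - b) * (8 * b) * o ^ 5) / 3

/-- The derivative of `kiteIrr` in `U`. -/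
def kiteIrrU (o a b V : ℝ) : ℝ :=
  -((2 * o ^ 2 + a * b) * ((3 * a - b) * b ^ 3 * ((3 * a - b) ^ 3 / 3) / 9
      + (3 * a - b) ^ 2 * V * o ^ 3 / 3) / 3)
    + (o ^ 2 + 2 * (a * b)) * (2 * a * b * V * o ^ 3 / 3
      + (3 * a - b) * (b * (a * b) * ((3 * a - b) ^ 3 / 3) / 3) / 3)

/-- The derivative of `kiteRat` in `V`. -/
def kiteRatV (o a b V : ℝ) : ℝ :=
  (3 * a - b) * (2 * o ^ 2 + a * b) * (a ^ 3 * ((3 * a - b) ^ 3 / 3) * o ^ 2)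
    - (o ^ 2 + 2 * (a * b)) * (2 * a ^ 2 * V * o ^ 5
      + (3 * a - b) * (a * (a * b) * ((3 * a - b) ^ 3 / 3) * o ^ 2) / 3)

/-- The derivative of `kiteIrr` in `V`. -/
def kiteIrrV (o a b U : ℝ) : ℝ :=
  -((2 * o ^ 2 + a * b) * (8 * b * (3 * a - b) * o ^ 7 / 3
      + (3 * a - b) ^ 2 * U * o ^ 3 / 3) / 3)
    + (o ^ 2 + 2 * (a * b)) * (2 * a * b * U * o ^ 3 / 3 + (3 * a - b) * (8 * a * o ^ 7) / 3)

/-- A homogenized upper bound of `(3 + b²) ^ (5/2) / 9` for `1 ≤ b ≤ 2`. -/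
def outerHi (o b : ℝ) : ℝ := (69 * b ^ 2 - 5 * o ^ 2) / 18

/-- Exact Taylor expansion; the quadratic term only lowers the value when `o ≥ 0` and `a b ≥ 0`. -/
theorem kite_step_U (o a b U U₀ V k : ℝ) :
    kiteRat o a b U V + k * kiteIrr o a b U V
      = kiteRat o a b U₀ V + k * kiteIrr o a b U₀ V
        + (U - U₀) * (kiteRatU o a b U₀ + k * kiteIrrU o a b V)
        - (o ^ 2 + 2 * (a * b)) * b ^ 2 * o / 3 * (U - U₀) ^ 2 := by
  unfold kiteRat kiteIrr kiteRatU kiteIrrU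
  ring

theorem kite_step_V (o a b U V V₀ k : ℝ) :
    kiteRat o a b U V + k * kiteIrr o a b U V
      = kiteRat o a b U V₀ + k * kiteIrr o a b U V₀
        + (V - V₀) * (kiteRatV o a b V₀ + k * kiteIrrV o a b U)
        - (o ^ 2 + 2 * (a * b)) * a ^ 2 * o ^ 5 * (V - V₀) ^ 2 := by
  unfold kiteRat kiteIrr kiteRatV kiteIrrV
  ring

/-- Coordinates for the outer region: `e = (a - 1)/2`, `d = b - 1 - 3e`, `f = 2 - b`, so that `o =
3e + d + f` stands for 1. The factors `3/2` and `2` enclose `√3`. -/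
theorem kite_neg_lo {e d f : ℝ} (he : 0 < e) (hd : 0 ≤ d) (hf : 0 ≤ f) :
    kiteRat (3 * e + d + f) (5 * e + d + f) (6 * e + 2 * d + f) (innerHi (3 * e + d + f) (5 * e + d + f)) (outerHi (3 * e + d + f) (6 * e + 2 * d + f))
      + 3 / 2 * kiteIrr (3 * e + d + f) (5 * e + d + f) (6 * e + 2 * d + f) (innerHi (3 * e + d + f) (5 * e + d + f)) (outerHi (3 * e + d + f) (6 * e + 2 * d + f)) < 0 := by
  rw [← neg_pos]
  unfold kiteRat kiteIrr innerHi outerHi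
  ring_nf
  positivity

theorem kite_U_neg_lo {e d f : ℝ} (he : 0 < e) (hd : 0 ≤ d) (hf : 0 ≤ f) :
    kiteRatU (3 * e + d + f) (5 * e + d + f) (6 * e + 2 * d + f) (innerHi (3 * e + d + f) (5 * e + d + f)) + 3 / 2 * kiteIrrU (3 * e + d + f) (5 * e + d + f) (6 * e + 2 * d + f) (outerHi (3 * e + d + f) (6 * e + 2 * d + f)) ≤ 0 := by
  rw [← neg_nonneg]
  unfold kiteRatU kiteIrrU innerHi outerHi
  ring_nf
  positivity

theorem kite_U_neg_zero_lo {e d f : ℝ} (he : 0 < e) (hd : 0 ≤ d) (hf : 0 ≤ f) :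
    kiteRatU (3 * e + d + f) (5 * e + d + f) (6 * e + 2 * d + f) (innerHi (3 * e + d + f) (5 * e + d + f)) + 3 / 2 * kiteIrrU (3 * e + d + f) (5 * e + d + f) (6 * e + 2 * d + f) 0 ≤ 0 := by
  rw [← neg_nonneg]
  unfold kiteRatU kiteIrrU innerHi
  ring_nf
  positivity

theorem kite_V_pos_lo {e d f : ℝ} (he : 0 < e) (hd : 0 ≤ d) (hf : 0 ≤ f) :
    0 ≤ kiteRatV (3 * e + d + f) (5 * e + d + f) (6 * e + 2 * d + f) (outerHi (3 * e + d + f) (6 * e + 2 * d + f)) + 3 / 2 * kiteIrrV (3 * e + d + f) (5 * e + d + f) (6 * e + 2 * d + f) (innerHi (3 * e + d + f) (5 * e + d + f)) := by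
  unfold kiteRatV kiteIrrV innerHi outerHi
  ring_nf
  positivity

theorem kite_neg_hi {e d f : ℝ} (he : 0 < e) (hd : 0 ≤ d) (hf : 0 ≤ f) :
    kiteRat (3 * e + d + f) (5 * e + d + f) (6 * e + 2 * d + f) (innerHi (3 * e + d + f) (5 * e + d + f)) (outerHi (3 * e + d + f) (6 * e + 2 * d + f))
      + 2 * kiteIrr (3 * e + d + f) (5 * e + d + f) (6 * e + 2 * d + f) (innerHi (3 * e + d + f) (5 * e + d + f)) (outerHi (3 * e + d + f) (6 * e + 2 * d + f)) < 0 := by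
  rw [← neg_pos]
  unfold kiteRat kiteIrr innerHi outerHi
  ring_nf
  positivity

theorem kite_U_neg_hi {e d f : ℝ} (he : 0 < e) (hd : 0 ≤ d) (hf : 0 ≤ f) :
    kiteRatU (3 * e + d + f) (5 * e + d + f) (6 * e + 2 * d + f) (innerHi (3 * e + d + f) (5 * e + d + f)) + 2 * kiteIrrU (3 * e + d + f) (5 * e + d + f) (6 * e + 2 * d + f) (outerHi (3 * e + d + f) (6 * e + 2 * d + f)) ≤ 0 := by
  rw [← neg_nonneg]
  unfold kiteRatU kiteIrrU innerHi outerHi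
  ring_nf
  positivity

theorem kite_U_neg_zero_hi {e d f : ℝ} (he : 0 < e) (hd : 0 ≤ d) (hf : 0 ≤ f) :
    kiteRatU (3 * e + d + f) (5 * e + d + f) (6 * e + 2 * d + f) (innerHi (3 * e + d + f) (5 * e + d + f)) + 2 * kiteIrrU (3 * e + d + f) (5 * e + d + f) (6 * e + 2 * d + f) 0 ≤ 0 := by
  rw [← neg_nonneg]
  unfold kiteRatU kiteIrrU innerHi
  ring_nf
  positivity

theorem kite_V_pos_hi {e d f : ℝ} (he : 0 < e) (hd : 0 ≤ d) (hf : 0 ≤ f) :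
    0 ≤ kiteRatV (3 * e + d + f) (5 * e + d + f) (6 * e + 2 * d + f) (outerHi (3 * e + d + f) (6 * e + 2 * d + f)) + 2 * kiteIrrV (3 * e + d + f) (5 * e + d + f) (6 * e + 2 * d + f) (innerHi (3 * e + d + f) (5 * e + d + f)) := by
  unfold kiteRatV kiteIrrV innerHi outerHi
  ring_nf
  positivity

/-- With `d + f = 1`, `b = 2 + d` and `a = 1 + e`, this bounds `√3 (y u⁵ - x v⁵)` from below, for
use against the upper bound in `kite_outer_far`. -/
theorem outer_far_pos {e d f : ℝ} (he : 0 ≤ e) (hd : 0 ≤ d) (hf : 0 < f) :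
    0 < (3 * d + 2 * f) * (3 * ((d + f) ^ 2 + 3 * ((d + f) * (1 + e)) ^ 2) ^ 2
          - 4 * ((d + f) ^ 2 + 3 * ((d + f) * (1 + e)) ^ 2) * (d + f) ^ 2) * (d + f) ^ 2
      - (d + f) * (1 + e) * (3 * (d + f) ^ 2 + (3 * d + 2 * f) ^ 2) ^ 2
          * (15 * (d + f) ^ 2 + (3 * d + 2 * f) ^ 2) / 36
      - 8 * (3 * ((d + f) * (1 + e)) - (3 * d + 2 * f))
          * (2 * (d + f) ^ 2 + (d + f) * (1 + e) * (3 * d + 2 * f)) * (d + f) ^ 4 := by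
  ring_nf
  positivity

/-- A polynomial in the coordinates `x`, `y` of the two particles on the axis of a kite and the fifth
powers `U`, `V` of their distances to the two others. It vanishes when both the symmetric and the
antisymmetric block of the Hessian are degenerate. -/
def kitePoly (x y U V : ℝ) : ℝ :=
  (x - y) * (2 + x * y) * (8 * x * U + x ^ 3 * V * (x - y) ^ 3 - y ^ 3 * U * (x - y) ^ 3
      - 8 * y * V - (x - y) * U * V - 8 * (x - y) * (x + y) ^ 2 * (x - y) ^ 3)
    - (1 + 2 * (x * y)) * (y * U - x * V)
      * (y * U - x * V + (x - y) * (8 - x * y * (x - y) ^ 3))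

/-- The scaling `x = √3 a`, `y = b/√3` puts the equilateral kite at `a = b = 1` and makes all
coefficients rational apart from one factor `k = √3`. -/
theorem kitePoly_rescale {k : ℝ} (hk : k ^ 2 = 3) (a b U V : ℝ) :
    kitePoly (k * a) (k * b / 3) U (k * V / 3)
      = kiteRat 1 a b U V + k * kiteIrr 1 a b U V := by
  have hP : k * a * (k * b / 3) = a * b := by linear_combination (a * b / 3) * hk
  have hg : k * a - k * b / 3 = k * ((3 * a - b) / 3) := by ring
  have hs : k * a + k * b / 3 = k * ((3 * a + b) / 3) := by ring
  have k3 : k ^ 3 = 3 * k := by linear_combination k * hk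
  have k4 : k ^ 4 = 9 := by linear_combination (k ^ 2 + 3) * hk
  have k5 : k ^ 5 = 9 * k := by linear_combination (k ^ 3 + 3 * k) * hk
  have k6 : k ^ 6 = 27 := by linear_combination (k ^ 4 + 3 * k ^ 2 + 9) * hk
  have k7 : k ^ 7 = 27 * k := by linear_combination k * k6
  have k8 : k ^ 8 = 81 := by linear_combination k ^ 2 * k6 + 27 * hk
  unfold kitePoly kiteRat kiteIrr
  rw [hP, hg, hs]
  ring_nf
  simp only [hk, k3, k4, k5, k6, k7, k8]
  ring

/-- Chord inequality for a concave quadratic `f` with leading coefficient `-c`. -/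
theorem pos_of_interval {f : ℝ → ℝ} {l h t c : ℝ} (hc : 0 ≤ c)
    (hf : (h - l) * f t = (h - t) * f l + (t - l) * f h + c * ((t - l) * (h - t) * (h - l)))
    (hl : l ≤ t) (hh : t ≤ h) (hfl : 0 < f l) (hfh : 0 < f h) : 0 < f t := by
  rcases hl.eq_or_lt with rfl | hl
  · exact hfl
  have h1 : 0 ≤ (h - t) * f l := mul_nonneg (sub_nonneg.mpr hh) hfl.le
  have h2 : 0 < (t - l) * f h := mul_pos (sub_pos.mpr hl) hfh
  have h3 : 0 ≤ c * ((t - l) * (h - t) * (h - l)) := mul_nonneg hc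
    (mul_nonneg (mul_nonneg (sub_pos.mpr hl).le (sub_nonneg.mpr hh)) (by linarith))
  exact pos_of_mul_pos_right (hf ▸ by linarith) (by linarith : 0 ≤ h - l)

theorem kite_combination_pos {o a b U V k : ℝ} (hk0 : 0 ≤ k) (hk2 : k ≤ 2)
    (h0 : 0 < kiteRat o a b U V) (h2 : 0 < kiteRat o a b U V + 2 * kiteIrr o a b U V) :
    0 < kiteRat o a b U V + k * kiteIrr o a b U V := by
  rcases hk2.eq_or_lt with rfl | hk2
  · exact h2
  · nlinarith [mul_nonneg hk0 h2.le, mul_pos (sub_pos.mpr hk2) h0]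

/-- The polynomial is concave in `U` and in `V` separately, so its minimum over the rectangle is at
a corner. -/
theorem kite_pos_of_corners {o a b k Ul Uh Vl Vh U V : ℝ} (ho : 0 ≤ o) (hab : 0 ≤ a * b)
    (hU : Ul ≤ U) (hU' : U ≤ Uh) (hV : Vl ≤ V) (hV' : V ≤ Vh)
    (h1 : 0 < kiteRat o a b Ul Vl + k * kiteIrr o a b Ul Vl)
    (h2 : 0 < kiteRat o a b Ul Vh + k * kiteIrr o a b Ul Vh)
    (h3 : 0 < kiteRat o a b Uh Vl + k * kiteIrr o a b Uh Vl)
    (h4 : 0 < kiteRat o a b Uh Vh + k * kiteIrr o a b Uh Vh) :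
    0 < kiteRat o a b U V + k * kiteIrr o a b U V := by
  have key : ∀ W, 0 < kiteRat o a b Ul W + k * kiteIrr o a b Ul W →
      0 < kiteRat o a b Uh W + k * kiteIrr o a b Uh W →
      0 < kiteRat o a b U W + k * kiteIrr o a b U W := fun W hl hh =>
    pos_of_interval (f := fun t => kiteRat o a b t W + k * kiteIrr o a b t W)
      (c := (o ^ 2 + 2 * (a * b)) * b ^ 2 * o / 3) (by positivity)
      (by simp only [kiteRat, kiteIrr]; ring) hU hU' hl hh
  exact pos_of_interval (f := fun t => kiteRat o a b U t + k * kiteIrr o a b U t)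
      (c := (o ^ 2 + 2 * (a * b)) * a ^ 2 * o ^ 5) (by positivity)
      (by simp only [kiteRat, kiteIrr]; ring) hV hV' (key Vl h1 h3) (key Vh h2 h4)

/-- In terms of `u` the bounds are `3u⁴ - 4u²`, touching `u⁵` to second order at `u = 2`, and `8u²`,
crossing it there. So `innerHi` becomes a lower bound beyond `u = 2`. -/
theorem inner_bounds_U {a u : ℝ} (hu : 0 < u) (hu2 : u ^ 2 = 1 + 3 * a ^ 2) :
    innerLo 1 a ≤ u ^ 5 ∧ (u ≤ 2 → u ^ 5 ≤ innerHi 1 a) ∧ (2 ≤ u → innerHi 1 a ≤ u ^ 5) := by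
  have hlo : innerLo 1 a = 3 * (u ^ 2) ^ 2 - 4 * u ^ 2 := by
    rw [innerLo, hu2]; ring
  have hhi : innerHi 1 a = 8 * u ^ 2 := by
    rw [innerHi, hu2]; ring
  have hfac : u ^ 5 - 8 * u ^ 2 = u ^ 2 * (u ^ 2 + 2 * u + 4) * (u - 2) := by ring
  have hpos : 0 < u ^ 2 * (u ^ 2 + 2 * u + 4) := by positivity
  refine ⟨?_, fun h => ?_, fun h => ?_⟩
  · have : 0 ≤ u ^ 2 * (u - 2) ^ 2 * (u + 1) := by positivity
    rw [hlo]
    linarith [show u ^ 5 - (3 * (u ^ 2) ^ 2 - 4 * u ^ 2) = u ^ 2 * (u - 2) ^ 2 * (u + 1) by ring]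
  · rw [hhi]
    nlinarith
  · rw [hhi]
    nlinarith

/-- In terms of `z²` the lower bound is the tangent at `z = 2`. The upper bound is also exact there,
and is close to the chord from `z = √3`. -/
theorem inner_bounds_V {b z : ℝ} (hz : 0 < z) (hz2 : z ^ 2 = 3 + b ^ 2) (hz' : z ≤ 2) :
    (12 * 1 ^ 2 + 20 * b ^ 2) / 9 ≤ z ^ 5 / 9 ∧ z ^ 5 / 9 ≤ (63 * 1 ^ 2 + 65 * b ^ 2) / 36 := by
  have hb2 : b ^ 2 = z ^ 2 - 3 := by linarith
  rw [hb2]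
  constructor
  · have : 0 ≤ (z - 2) ^ 2 * (z ^ 3 + 4 * z ^ 2 + 12 * z + 12) := by positivity
    nlinarith
  · have h1 : 17 / 10 < z := by nlinarith [sq_nonneg b]
    have h2 : 0 ≤ 4 * z ^ 4 + 8 * z ^ 3 + 16 * z ^ 2 - 33 * z - 66 := by
      have e : 4 * z ^ 4 + 8 * z ^ 3 + 16 * z ^ 2 - 33 * z - 66
        = z ^ 2 * (4 * z ^ 2 - 12) + 8 * z * (z ^ 2 - 3) + 28 * (z ^ 2 - 3) + (18 - 9 * z) := by ring
      have h3 : 0 ≤ z ^ 2 - 3 := by nlinarith [sq_nonneg b]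
      rw [e]
      have : 0 ≤ z ^ 2 * (4 * z ^ 2 - 12) := mul_nonneg (sq_nonneg z) (by linarith)
      have : 0 ≤ 8 * z * (z ^ 2 - 3) := mul_nonneg (by linarith) h3
      linarith
    nlinarith [mul_nonneg (sub_nonneg.mpr hz') h2]

theorem outer_bound_V {b z : ℝ} (hz2 : z ^ 2 = 3 + b ^ 2) (hz' : 2 ≤ z) (hb : b ^ 2 ≤ 4) :
    z ^ 5 / 9 ≤ outerHi 1 b := by
  have hb2 : b ^ 2 = z ^ 2 - 3 := by linarith
  have h7 : z ^ 2 ≤ 7 := by linarith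
  have h1 : z ≤ 27 / 10 := by nlinarith
  have h2 : 2 * z ^ 4 + 4 * z ^ 3 + 8 * z ^ 2 - 53 * z - 106 ≤ 0 := by
    have h3 : z ^ 4 ≤ 7 * z ^ 2 := by nlinarith [sq_nonneg z]
    have h4 : z ^ 3 ≤ 7 * z := by nlinarith
    linarith
  rw [outerHi, hb2]
  nlinarith [mul_nonneg (sub_nonneg.mpr hz') (neg_nonneg.mpr h2)]

theorem kitePoly_pos {x y u v : ℝ} (hx : 0 < x) (hy : 0 < y) (hx3 : x ^ 2 < 3)
    (hxy : 1 + 2 * (x * y) < x ^ 2) (hu : 0 < u) (hu2 : u ^ 2 = 1 + x ^ 2) (hv : 0 < v)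
    (hv2 : v ^ 2 = 1 + y ^ 2) : 0 < kitePoly x y (u ^ 5) (v ^ 5) := by
  obtain ⟨k, hk0, hk⟩ : ∃ k : ℝ, 0 < k ∧ k ^ 2 = 3 := ⟨√3, by positivity, by norm_num⟩
  have hk2 : k ≤ 2 := by nlinarith
  obtain ⟨a, rfl⟩ : ∃ a, x = k * a := ⟨x / k, by field_simp⟩
  obtain ⟨b, rfl⟩ : ∃ b, y = k * b / 3 := ⟨3 * y / k, by field_simp⟩
  have ha : 0 < a := pos_of_mul_pos_right hx hk0.le
  have hb : 0 < b := by
    have : 0 < k * b := by linarith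
    exact pos_of_mul_pos_right this hk0.le
  have hP : k * a * (k * b / 3) = a * b := by linear_combination (a * b / 3) * hk
  have hu2' : u ^ 2 = 1 + 3 * a ^ 2 := by linear_combination hu2 + a ^ 2 * hk
  have hz2 : (k * v) ^ 2 = 3 + b ^ 2 := by
    linear_combination k ^ 2 * hv2 + (1 + b ^ 2 * (k ^ 2 + 3) / 9) * hk
  have hV : v ^ 5 = k * ((k * v) ^ 5 / 9) / 3 := by
    linear_combination (-(v ^ 5 * (k ^ 4 + 3 * k ^ 2 + 9) / 27)) * hk
  have ha1 : a < 1 := by nlinarith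
  rw [hP] at hxy
  -- The tangent at `a = b = 1` to the curve `1 + 2ab = 3a²` makes the region a triangle.
  have hb1 : b ≤ 2 * a - 1 := by nlinarith [sq_nonneg (a - 1)]
  rw [hV, kitePoly_rescale hk]
  obtain ⟨e, he, rfl⟩ : ∃ e, 0 < e ∧ a = 1 - e := ⟨1 - a, by linarith, by ring⟩
  obtain ⟨d, hd, hd'⟩ : ∃ d, 0 ≤ d ∧ d = 1 - 2 * e - b := ⟨1 - 2 * e - b, by linarith, rfl⟩
  have ho : (1 : ℝ) = b + 2 * e + d := by linarith
  have hae : 1 - e = b + e + d := by linarith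
  obtain ⟨hU1, hU2, -⟩ := inner_bounds_U hu hu2'
  have hu_le : u ≤ 2 := by nlinarith
  obtain ⟨hV1, hV2⟩ := inner_bounds_V (by positivity) hz2 (by nlinarith : k * v ≤ 2)
  have hU2 := hU2 hu_le
  rw [hae, ho] at hU1 hU2
  rw [ho] at hV1 hV2
  rw [hae, ho]
  refine kite_pos_of_corners (by positivity) (by positivity) hU1 hU2 hV1 hV2 ?_ ?_ ?_ ?_
  · exact kite_combination_pos hk0.le hk2 (kiteRat_pos_lo_lo hb he hd)
      (kiteRat_add_pos_lo_lo hb he hd)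
  · exact kite_combination_pos hk0.le hk2 (kiteRat_pos_lo_hi hb he hd)
      (kiteRat_add_pos_lo_hi hb he hd)
  · exact kite_combination_pos hk0.le hk2 (kiteRat_pos_hi_lo hb he hd)
      (kiteRat_add_pos_hi_lo hb he hd)
  · exact kite_combination_pos hk0.le hk2 (kiteRat_pos_hi_hi hb he hd)
      (kiteRat_add_pos_hi_hi hb he hd)

theorem kite_outer_neg {a b k U V : ℝ} (hk1 : 3 / 2 ≤ k) (hk2 : k ≤ 2) (ha1 : 1 < a)
    (hb1 : 3 * a ≤ 2 * b + 1) (hb2 : b ≤ 2) (hU2 : innerHi 1 a ≤ U) (hV0 : 0 ≤ V)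
    (hVle : V ≤ outerHi 1 b) : kiteRat 1 a b U V + k * kiteIrr 1 a b U V < 0 := by
  obtain ⟨e, he, hae⟩ : ∃ e, 0 < e ∧ a = 1 + 2 * e := ⟨(a - 1) / 2, by linarith, by ring⟩
  obtain ⟨d, hd, hbd⟩ : ∃ d, 0 ≤ d ∧ b = 1 + 3 * e + d := ⟨b - 1 - 3 * e, by linarith, by ring⟩
  obtain ⟨f, hf, hf'⟩ : ∃ f, 0 ≤ f ∧ f = 2 - b := ⟨2 - b, by linarith, rfl⟩
  have ho : (1 : ℝ) = 3 * e + d + f := by linarith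
  have hae' : a = 5 * e + d + f := by linarith
  have hbd' : b = 6 * e + 2 * d + f := by linarith
  have hab : 0 ≤ a * b := mul_nonneg (by linarith) (by linarith)
  have lin : ∀ {p q : ℝ}, p + 3 / 2 * q ≤ 0 → p + 2 * q ≤ 0 → p + k * q ≤ 0 := by
    intro p q h1 h2
    nlinarith [mul_nonneg (sub_nonneg.mpr hk1) (neg_nonneg.mpr h2),
      mul_nonneg (sub_nonneg.mpr hk2) (neg_nonneg.mpr h1)]
  have linlt : ∀ {p q : ℝ}, p + 3 / 2 * q < 0 → p + 2 * q < 0 → p + k * q < 0 := by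
    intro p q h1 h2
    rcases hk2.eq_or_lt with rfl | hk2
    · exact h2
    nlinarith [mul_nonneg (sub_nonneg.mpr hk1) (neg_nonneg.mpr h2.le),
      mul_pos (sub_pos.mpr hk2) (neg_pos.mpr h1)]
  have hA : kiteRat 1 a b (innerHi 1 a) (outerHi 1 b)
      + k * kiteIrr 1 a b (innerHi 1 a) (outerHi 1 b) < 0 := by
    rw [ho, hae', hbd']
    exact linlt (kite_neg_lo he hd hf) (kite_neg_hi he hd hf)
  have hB : kiteRatU 1 a b (innerHi 1 a) + k * kiteIrrU 1 a b (outerHi 1 b) ≤ 0 := by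
    rw [ho, hae', hbd']
    exact lin (kite_U_neg_lo he hd hf) (kite_U_neg_hi he hd hf)
  have hC : kiteRatU 1 a b (innerHi 1 a) + k * kiteIrrU 1 a b 0 ≤ 0 := by
    rw [ho, hae', hbd']
    exact lin (kite_U_neg_zero_lo he hd hf) (kite_U_neg_zero_hi he hd hf)
  have hE : 0 ≤ kiteRatV 1 a b (outerHi 1 b) + k * kiteIrrV 1 a b (innerHi 1 a) := by
    have h1 := kite_V_pos_lo he hd hf
    have h2 := kite_V_pos_hi he hd hf
    rw [← ho, ← hae', ← hbd'] at h1 h2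
    have := lin (p := -kiteRatV 1 a b (outerHi 1 b)) (q := -kiteIrrV 1 a b (innerHi 1 a))
      (by linarith) (by linarith)
    linarith
  -- The expression is affine in `V`, so the endpoints `0` and `outerHi` suffice.
  have hBV : kiteRatU 1 a b (innerHi 1 a) + k * kiteIrrU 1 a b V ≤ 0 := by
    have hlin : outerHi 1 b * (kiteRatU 1 a b (innerHi 1 a) + k * kiteIrrU 1 a b V)
        = V * (kiteRatU 1 a b (innerHi 1 a) + k * kiteIrrU 1 a b (outerHi 1 b))
          + (outerHi 1 b - V) * (kiteRatU 1 a b (innerHi 1 a) + k * kiteIrrU 1 a b 0) := by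
      unfold kiteIrrU
      ring
    have hpos : 0 < outerHi 1 b := by
      rw [outerHi]
      nlinarith
    nlinarith [mul_nonneg hV0 (neg_nonneg.mpr hB),
      mul_nonneg (sub_nonneg.mpr hVle) (neg_nonneg.mpr hC)]
  rw [kite_step_U 1 a b U (innerHi 1 a) V k, kite_step_V 1 a b (innerHi 1 a) V (outerHi 1 b) k]
  have h1 := mul_nonneg (sub_nonneg.mpr hU2) (neg_nonneg.mpr hBV)
  have h2 := mul_nonneg (sub_nonneg.mpr hVle) hE
  have h3 : 0 ≤ (1 ^ 2 + 2 * (a * b)) * b ^ 2 * 1 / 3 * (U - innerHi 1 a) ^ 2 := by positivity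
  have h4 : 0 ≤ (1 ^ 2 + 2 * (a * b)) * a ^ 2 * 1 ^ 5 * (V - outerHi 1 b) ^ 2 := by positivity
  linarith

theorem kite_outer_far {a b k u v : ℝ} (hk0 : 0 < k) (hk : k ^ 2 = 3) (ha1 : 1 < a)
    (hb2 : 2 < b) (hb3 : b < 3) (hU1 : innerLo 1 a ≤ u ^ 5) (hz2 : (k * v) ^ 2 = 3 + b ^ 2)
    (hv : 0 < v)
    (hD : k * b / 3 * u ^ 5 - k * a * v ^ 5 < 8 * (k * a - k * b / 3) * (2 + a * b)) : False := by
  obtain ⟨e, he, rfl⟩ : ∃ e, 0 ≤ e ∧ a = 1 + e := ⟨a - 1, by linarith, by ring⟩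
  obtain ⟨d, hd, rfl⟩ : ∃ d, 0 ≤ d ∧ b = 2 + d := ⟨b - 2, by linarith, by ring⟩
  obtain ⟨f, hf, hf'⟩ : ∃ f, 0 < f ∧ f = 1 - d := ⟨1 - d, by linarith, rfl⟩
  have h := outer_far_pos he hd hf
  rw [show d + f = 1 by linarith, show 3 * d + 2 * f = 2 + d by linarith] at h
  have hVk : k ^ 2 * v ^ 5 ≤ (3 + (2 + d) ^ 2) ^ 2 * (15 + (2 + d) ^ 2) / 36 := by
    have e1 : (3 + (2 + d) ^ 2) ^ 2 * (15 + (2 + d) ^ 2) / 36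
        = 9 * v ^ 4 * (3 * v ^ 2 + 12) / 36 := by
      rw [← hz2, show (15 : ℝ) + (2 + d) ^ 2 = (k * v) ^ 2 + 12 by rw [hz2]; ring, mul_pow, hk]
      ring
    rw [e1, hk]
    -- `4v ≤ v² + 4` bounds `v⁵` by even powers of `v`, hence by a polynomial in `b`.
    have : 0 ≤ 3 / 4 * v ^ 4 * (v - 2) ^ 2 := by positivity
    nlinarith
  have hUb : 0 ≤ (2 + d) * (u ^ 5 - innerLo 1 (1 + e)) :=
    mul_nonneg (by positivity) (sub_nonneg.mpr hU1)
  unfold innerLo at hUb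
  have hVb := mul_le_mul_of_nonneg_left hVk (by positivity : (0 : ℝ) ≤ 1 + e)
  have hD' := mul_lt_mul_of_pos_left hD hk0
  have e2 : k * (k * (2 + d) / 3 * u ^ 5 - k * (1 + e) * v ^ 5)
      = (2 + d) * u ^ 5 - (1 + e) * (k ^ 2 * v ^ 5) := by
    linear_combination ((2 + d) / 3 * u ^ 5) * hk
  have e3 : k * (8 * (k * (1 + e) - k * (2 + d) / 3) * (2 + (1 + e) * (2 + d)))
      = 8 * (3 * (1 + e) - (2 + d)) * (2 + (1 + e) * (2 + d)) := by
    linear_combination (8 * ((1 + e) - (2 + d) / 3) * (2 + (1 + e) * (2 + d))) * hk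
  rw [e2, e3] at hD'
  linarith

theorem kitePoly_neg {x y u v : ℝ} (hx : 0 < x) (hy : 0 < y) (hx3 : 3 < x ^ 2)
    (hxy : x ^ 2 < 1 + 2 * (x * y)) (hu : 0 < u) (hu2 : u ^ 2 = 1 + x ^ 2) (hv : 0 < v)
    (hv2 : v ^ 2 = 1 + y ^ 2) (hv' : v < 2)
    (hD : y * u ^ 5 - x * v ^ 5 < 8 * (x - y) * (2 + x * y)) :
    kitePoly x y (u ^ 5) (v ^ 5) < 0 := by
  obtain ⟨k, hk0, hk⟩ : ∃ k : ℝ, 0 < k ∧ k ^ 2 = 3 := ⟨√3, by positivity, by norm_num⟩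
  have hk2 : k ≤ 2 := by nlinarith
  have hk1 : 3 / 2 ≤ k := by nlinarith
  obtain ⟨a, rfl⟩ : ∃ a, x = k * a := ⟨x / k, by field_simp⟩
  obtain ⟨b, rfl⟩ : ∃ b, y = k * b / 3 := ⟨3 * y / k, by field_simp⟩
  have ha : 0 < a := pos_of_mul_pos_right hx hk0.le
  have hb : 0 < b := by
    have : 0 < k * b := by linarith
    exact pos_of_mul_pos_right this hk0.le
  have hP : k * a * (k * b / 3) = a * b := by linear_combination (a * b / 3) * hk
  have hu2' : u ^ 2 = 1 + 3 * a ^ 2 := by linear_combination hu2 + a ^ 2 * hk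
  have hz2 : (k * v) ^ 2 = 3 + b ^ 2 := by
    linear_combination k ^ 2 * hv2 + (1 + b ^ 2 * (k ^ 2 + 3) / 9) * hk
  have hV : v ^ 5 = k * ((k * v) ^ 5 / 9) / 3 := by
    linear_combination (-(v ^ 5 * (k ^ 4 + 3 * k ^ 2 + 9) / 27)) * hk
  have ha1 : 1 < a := by nlinarith
  rw [hP] at hxy hD
  have hxy' : 3 * a ^ 2 < 1 + 2 * (a * b) := by
    rwa [mul_pow, hk] at hxy
  -- Linear relaxation of `3a² < 1 + 2ab`, using `a > 1`.
  have hb1 : 3 * a ≤ 2 * b + 1 := by nlinarith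
  obtain ⟨hU1, -, hU2⟩ := inner_bounds_U hu hu2'
  have hu_ge : 2 ≤ u := by nlinarith
  have hU2 := hU2 hu_ge
  have hb3 : b < 3 := by nlinarith
  have hb1' : 1 ≤ b := by linarith
  -- For `b ≤ 2` the polynomial itself is estimated; for `2 < b < 3` the hypothesis `hD` already
  -- fails.
  rcases le_or_gt b 2 with hb2 | hb2
  · have hz : 2 ≤ k * v := by
      refine (sq_le_sq₀ (by norm_num) (by positivity)).mp ?_
      rw [hz2]
      linarith [one_le_pow₀ (n := 2) hb1']
    have hVle := outer_bound_V hz2 hz (by linarith [pow_le_pow_left₀ hb.le hb2 2])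
    rw [hV, kitePoly_rescale hk]
    exact kite_outer_neg hk1 hk2 ha1 hb1 hb2 hU2 (by positivity) hVle
  · exact (kite_outer_far hk0 hk ha1 hb2 hb3 hU1 hz2 hv hD).elim

/-! ### Stresses of a kite and the two blocks of the Hessian -/

theorem lt_of_one_div_cube_lt {a b : ℝ} (ha : 0 < a) (h : 1 / a ^ 3 < 1 / b ^ 3) : b < a := by
  by_contra! hab
  exact absurd h (not_lt.mpr (one_div_le_one_div_of_le (by positivity)
    (pow_le_pow_left₀ ha.le hab 3)))

theorem eq_of_one_div_cube_eq {a b : ℝ} (ha : 0 < a) (hb : 0 < b) (h : 1 / a ^ 3 = 1 / b ^ 3) :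
    a = b := by
  rw [one_div, one_div, inv_inj] at h
  exact (pow_left_inj₀ ha.le hb.le (by norm_num)).mp h

/-- The central configuration equations of a kite with two particles of mass `μ` at `± i` and
particles of mass `m₂`, `m₃` at `x`, `y`. -/
structure KiteStress (μ m₂ m₃ x y u v L : ℝ) : Prop where
  hμ : 0 < μ
  hm₂ : 0 < m₂
  hm₃ : 0 < m₃
  hx : 0 < x
  hyx : y < x
  hu : 0 < u
  hu2 : u ^ 2 = 1 + x ^ 2
  hv : 0 < v
  hv2 : v ^ 2 = 1 + y ^ 2
  eq_re : m₂ * (1 / u ^ 3 - L) * x + m₃ * (1 / v ^ 3 - L) * y = 0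
  eq_im : 2 * μ * (1 / 8 - L) + m₂ * (1 / u ^ 3 - L) + m₃ * (1 / v ^ 3 - L) = 0
  eq_two : 2 * μ * (1 / u ^ 3 - L) * x + m₃ * (1 / (x - y) ^ 3 - L) * (x - y) = 0
  eq_three : 2 * μ * (1 / v ^ 3 - L) * y - m₂ * (1 / (x - y) ^ 3 - L) * (x - y) = 0

namespace KiteStress

variable {μ m₂ m₃ x y u v L : ℝ}

theorem y_ne_zero (h : KiteStress μ m₂ m₃ x y u v L) : y ≠ 0 := by
  rintro rfl
  have h1 := h.eq_re
  have h2 := h.eq_two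
  have h3 : m₂ * (1 / u ^ 3 - L) * x = 0 := by linarith
  have h4 : 1 / u ^ 3 - L = 0 := by
    rcases mul_eq_zero.mp h3 with h3 | h3
    · exact (mul_eq_zero.mp h3).resolve_left h.hm₂.ne'
    · exact absurd h3 h.hx.ne'
  rw [h4, mul_zero, zero_mul, zero_add, sub_zero, mul_eq_zero, or_iff_left h.hx.ne', mul_eq_zero,
    or_iff_right h.hm₃.ne'] at h2
  have h5 : u = x := eq_of_one_div_cube_eq h.hu h.hx (by linarith)
  have := h.hu2
  rw [h5] at this
  linarith

theorem eq_one (h : KiteStress μ m₂ m₃ x y u v L) :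
    2 * μ * (1 / 8 - L) * x + m₃ * (1 / v ^ 3 - L) * (x - y) = 0 := by
  linear_combination x * h.eq_im - h.eq_re

/-- Dziobek's relation between the stresses of opposite edges, free of the masses. -/
theorem product_eq (h : KiteStress μ m₂ m₃ x y u v L) :
    (1 / 8 - L) * (1 / (x - y) ^ 3 - L) = (1 / u ^ 3 - L) * (1 / v ^ 3 - L) := by
  have hne : 2 * μ * x * (m₃ * (x - y)) ≠ 0 := by
    have := h.hμ
    have := h.hx
    have := h.hm₃
    have := sub_pos.mpr h.hyx
    positivity
  refine mul_left_cancel₀ hne ?_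
  linear_combination (m₃ * (1 / (x - y) ^ 3 - L) * (x - y)) * h.eq_one
    - (m₃ * (1 / v ^ 3 - L) * (x - y)) * h.eq_two

theorem signs_of_pos (h : KiteStress μ m₂ m₃ x y u v L) (hv : 0 < 1 / v ^ 3 - L) :
    1 / 8 - L < 0 := by
  have h1 := h.eq_one
  have h2 : 0 < m₃ * (1 / v ^ 3 - L) * (x - y) :=
    mul_pos (mul_pos h.hm₃ hv) (sub_pos.mpr h.hyx)
  have h3 : 2 * μ * x * (1 / 8 - L) < 0 := by linarith
  exact neg_of_mul_neg_right h3 (by have := h.hμ; have := h.hx; positivity)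

/-- The signs of the stresses of a concave kite. -/
theorem concave_signs (h : KiteStress μ m₂ m₃ x y u v L) (hy : 0 < y) :
    1 / 8 < L ∧ 1 / u ^ 3 < L ∧ L < 1 / v ^ 3 ∧ L < 1 / (x - y) ^ 3 := by
  have hx := h.hx
  have hμ := h.hμ
  have hm₂ := h.hm₂
  have hm₃ := h.hm₃
  have hg := sub_pos.mpr h.hyx
  have hvu : v < u := by
    refine lt_of_pow_lt_pow_left₀ 2 h.hu.le ?_
    rw [h.hu2, h.hv2]
    nlinarith [h.hyx]
  have hlt : 1 / u ^ 3 < 1 / v ^ 3 :=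
    one_div_lt_one_div_of_lt (pow_pos h.hv 3) (pow_lt_pow_left₀ hvu h.hv.le (by norm_num))
  have h1 := h.eq_re
  have hS : 0 < 1 / v ^ 3 - L := by
    by_contra! hle
    have h2 : m₃ * (1 / v ^ 3 - L) * y ≤ 0 :=
      mul_nonpos_of_nonpos_of_nonneg (mul_nonpos_of_nonneg_of_nonpos hm₃.le hle) hy.le
    have h3 : 0 ≤ m₂ * x * (1 / u ^ 3 - L) := by linarith
    have := nonneg_of_mul_nonneg_right h3 (by positivity)
    linarith
  have h2 : 0 < m₃ * (1 / v ^ 3 - L) * y := by positivity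
  have h3 : m₂ * x * (1 / u ^ 3 - L) < 0 := by linarith
  have h4 : 1 / u ^ 3 - L < 0 := neg_of_mul_neg_right h3 (by positivity)
  have h5 : 0 < m₃ * (x - y) * (1 / (x - y) ^ 3 - L) := by
    have := h.eq_two
    have : 2 * μ * x * (1 / u ^ 3 - L) < 0 := mul_neg_of_pos_of_neg (by positivity) h4
    linarith
  have h6 := pos_of_mul_pos_right h5 (by positivity)
  have h7 := h.signs_of_pos hS
  exact ⟨by linarith, by linarith, by linarith, by linarith⟩

/-- The signs of the stresses of a convex kite. -/
theorem convex_signs (h : KiteStress μ m₂ m₃ x y u v L) (hy : y < 0) :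
    1 / 8 < L ∧ L < 1 / u ^ 3 ∧ L < 1 / v ^ 3 := by
  have hx := h.hx
  have hμ := h.hμ
  have hm₂ := h.hm₂
  have hm₃ := h.hm₃
  have hg := sub_pos.mpr h.hyx
  have h1 := h.eq_re
  have hS : 0 < 1 / v ^ 3 - L := by
    -- Otherwise the diagonals would satisfy `2 ≥ L^(-1/3)`-type comparisons in reverse: `2 ≤ v` and
    -- `x - y ≤ u`, incompatible with `x y < 0`.
    by_contra! hle
    have h2 : 0 ≤ m₃ * (1 / v ^ 3 - L) * y :=
      mul_nonneg_of_nonpos_of_nonpos (mul_nonpos_of_nonneg_of_nonpos hm₃.le hle) hy.le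
    have h3 : m₂ * x * (1 / u ^ 3 - L) ≤ 0 := by linarith
    have hu0 : 1 / u ^ 3 - L ≤ 0 := nonpos_of_mul_nonpos_right h3 (by positivity)
    have h8 : 0 ≤ 1 / 8 - L := by
      have h4 : m₃ * (1 / v ^ 3 - L) * (x - y) ≤ 0 :=
        mul_nonpos_of_nonpos_of_nonneg (mul_nonpos_of_nonneg_of_nonpos hm₃.le hle) hg.le
      have h5 : 0 ≤ 2 * μ * x * (1 / 8 - L) := by linarith [h.eq_one]
      exact nonneg_of_mul_nonneg_right h5 (by positivity)
    have hG : 0 ≤ 1 / (x - y) ^ 3 - L := by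
      have h4 : 2 * μ * x * (1 / u ^ 3 - L) ≤ 0 :=
        mul_nonpos_of_nonneg_of_nonpos (by positivity) hu0
      have h5 : 0 ≤ m₃ * (x - y) * (1 / (x - y) ^ 3 - L) := by linarith [h.eq_two]
      exact nonneg_of_mul_nonneg_right h5 (by positivity)
    have hv2 : 2 ≤ v := by
      by_contra! hlt
      have := one_div_lt_one_div_of_lt (pow_pos h.hv 3)
        (pow_lt_pow_left₀ hlt h.hv.le (n := 3) (by norm_num))
      norm_num at this h8 hle
      linarith
    have hgu : x - y ≤ u := by
      by_contra! hlt
      have := one_div_lt_one_div_of_lt (pow_pos h.hu 3)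
        (pow_lt_pow_left₀ hlt h.hu.le (n := 3) (by norm_num))
      linarith
    have h6 := pow_le_pow_left₀ hg.le hgu 2
    have h7 := pow_le_pow_left₀ (by norm_num) hv2 2
    rw [h.hu2] at h6
    rw [h.hv2] at h7
    nlinarith
  have h2 : m₃ * (1 / v ^ 3 - L) * y < 0 := mul_neg_of_pos_of_neg (by positivity) hy
  have h3 : 0 < m₂ * x * (1 / u ^ 3 - L) := by linarith
  have h4 := pos_of_mul_pos_right h3 (by positivity)
  have h7 := h.signs_of_pos hS
  exact ⟨by linarith, by linarith, by linarith⟩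

/-- The antisymmetric part of the kernel equations, for the displacements `±a` of the first two
particles and `i p`, `i q` of the two others. -/
theorem odd_eqs (h : KiteStress μ m₂ m₃ x y u v L) {a p q : ℝ}
    (h₂ : 2 * μ * (3 * (x * a + p) / u ^ 5 - (1 / u ^ 3 - L) * p)
      - m₃ * (1 / (x - y) ^ 3 - L) * (p - q) = 0)
    (h₃ : 2 * μ * (3 * (y * a + q) / v ^ 5 - (1 / v ^ 3 - L) * q)
      + m₂ * (1 / (x - y) ^ 3 - L) * (p - q) = 0) :
    3 * (x - y) * (x * a + p) = (L * u ^ 5 - u ^ 2) * (y * p - x * q) ∧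
      3 * (x - y) * (y * a + q) = -((v ^ 2 - L * v ^ 5) * (y * p - x * q)) := by
  have hμ := h.hμ.ne'
  have hu := h.hu.ne'
  have hv := h.hv.ne'
  -- Force balance trades the stress between the two axis particles for the one towards `±i`, and
  -- the masses factor out.
  have e2 : 2 * μ * (3 * (x - y) * (x * a + p) / u ^ 5 + (1 / u ^ 3 - L) * (y * p - x * q)) = 0 := by
    linear_combination (x - y) * h₂ + (p - q) * h.eq_two
  have e3 : 2 * μ * (3 * (x - y) * (y * a + q) / v ^ 5 + (1 / v ^ 3 - L) * (y * p - x * q)) = 0 := by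
    linear_combination (x - y) * h₃ + (p - q) * h.eq_three
  rw [mul_eq_zero, or_iff_right (by positivity)] at e2 e3
  constructor
  · field_simp at e2
    linear_combination e2
  · field_simp at e3
    linear_combination e3

/-- The conclusion `p = -x a`, `q = -y a` describes an infinitesimal rotation. -/
theorem odd_trivial (h : KiteStress μ m₂ m₃ x y u v L) {a p q : ℝ}
    (h₂ : 2 * μ * (3 * (x * a + p) / u ^ 5 - (1 / u ^ 3 - L) * p)
      - m₃ * (1 / (x - y) ^ 3 - L) * (p - q) = 0)
    (h₃ : 2 * μ * (3 * (y * a + q) / v ^ 5 - (1 / v ^ 3 - L) * q)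
      + m₂ * (1 / (x - y) ^ 3 - L) * (p - q) = 0)
    (hl : y * p - x * q = 0) : x * a + p = 0 ∧ y * a + q = 0 := by
  obtain ⟨e2, e3⟩ := h.odd_eqs h₂ h₃
  have hg := (sub_pos.mpr h.hyx).ne'
  rw [hl, mul_zero, mul_eq_zero, or_iff_right (by simpa using hg)] at e2
  rw [hl, mul_zero, neg_zero, mul_eq_zero, or_iff_right (by simpa using hg)] at e3
  exact ⟨e2, e3⟩

/-- Combining `odd_eqs` with weights `y` and `-x` eliminates `a`; the common factor `y p - x q` then
cancels. -/
theorem odd_condition (h : KiteStress μ m₂ m₃ x y u v L) {a p q : ℝ}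
    (h₂ : 2 * μ * (3 * (x * a + p) / u ^ 5 - (1 / u ^ 3 - L) * p)
      - m₃ * (1 / (x - y) ^ 3 - L) * (p - q) = 0)
    (h₃ : 2 * μ * (3 * (y * a + q) / v ^ 5 - (1 / v ^ 3 - L) * q)
      + m₂ * (1 / (x - y) ^ 3 - L) * (p - q) = 0)
    (hl : y * p - x * q ≠ 0) : L * (y * u ^ 5 - x * v ^ 5) = (x - y) * (2 + x * y) := by
  obtain ⟨e2, e3⟩ := h.odd_eqs h₂ h₃
  refine mul_right_cancel₀ hl ?_
  linear_combination -(y * e2 - x * e3)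
    + (y * p - x * q) * (y * h.hu2 - x * h.hv2)

/-- The symmetric part of the kernel equations, for the displacements `± i b` of the first two
particles and `p`, `q` of the two others. -/
theorem even_trivial (h : KiteStress μ m₂ m₃ x y u v L) {b p q : ℝ}
    (h₂ : 2 * μ * (3 * x * (x * p + b) / u ^ 5 - (1 / u ^ 3 - L) * p)
      + m₃ * (3 / (x - y) ^ 3 - (1 / (x - y) ^ 3 - L)) * (p - q) = 0)
    (h₃ : 2 * μ * (3 * y * (y * q + b) / v ^ 5 - (1 / v ^ 3 - L) * q)
      - m₂ * (3 / (x - y) ^ 3 - (1 / (x - y) ^ 3 - L)) * (p - q) = 0)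
    (h₀ : μ * (3 / 4 * b - 2 * (1 / 8 - L) * b) + m₂ * (3 * (x * p + b) / u ^ 5 - (1 / u ^ 3 - L) * b)
      + m₃ * (3 * (y * q + b) / v ^ 5 - (1 / v ^ 3 - L) * b) = 0)
    (hl : y * p - x * q = 0) : b = 0 ∧ p = 0 ∧ q = 0 := by
  have hμ := h.hμ
  have hm₂ := h.hm₂
  have hm₃ := h.hm₃
  have hu := h.hu
  have hv := h.hv
  have hg := sub_pos.mpr h.hyx
  -- Once `y p = x q`, force balance removes every stress term and only changes of length remain.
  have e2 : (x - y) * (2 * μ * x * (x * p + b) / u ^ 5 + m₃ * (p - q) / (x - y) ^ 3) = 0 := by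
    linear_combination (x - y) * h₂ / 3 + (p - q) * h.eq_two / 3
      - 2 * μ * (1 / u ^ 3 - L) * hl / 3
  have e3 : (x - y) * (2 * μ * y * (y * q + b) / v ^ 5 - m₂ * (p - q) / (x - y) ^ 3) = 0 := by
    linear_combination (x - y) * h₃ / 3 + (p - q) * h.eq_three / 3
      - 2 * μ * (1 / v ^ 3 - L) * hl / 3
  have e0 : μ * b / 4 + m₂ * (x * p + b) / u ^ 5 + m₃ * (y * q + b) / v ^ 5 = 0 := by
    linear_combination h₀ / 3 + b / 3 * h.eq_im
  have e2 := (mul_eq_zero.mp e2).resolve_left hg.ne'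
  have e3 := (mul_eq_zero.mp e3).resolve_left hg.ne'
  -- Pairing the equations with the displacement leaves a sum of squares with positive weights.
  have hsum : 2 * μ * m₂ / u ^ 5 * (x * p + b) ^ 2 + 2 * μ * m₃ / v ^ 5 * (y * q + b) ^ 2
      + m₂ * m₃ / (x - y) ^ 3 * (p - q) ^ 2 + μ ^ 2 / 2 * b ^ 2 = 0 := by
    linear_combination m₂ * p * e2 + m₃ * q * e3 + 2 * μ * b * e0
  have t1 : 0 ≤ 2 * μ * m₂ / u ^ 5 * (x * p + b) ^ 2 := by positivity
  have t2 : 0 ≤ 2 * μ * m₃ / v ^ 5 * (y * q + b) ^ 2 := by positivity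
  have t3 : 0 ≤ m₂ * m₃ / (x - y) ^ 3 * (p - q) ^ 2 := by positivity
  have t4 : 0 ≤ μ ^ 2 / 2 * b ^ 2 := by positivity
  have hb : b = 0 := by
    have : μ ^ 2 / 2 * b ^ 2 = 0 := by linarith
    rw [mul_eq_zero, or_iff_right (by positivity)] at this
    exact pow_eq_zero_iff (two_ne_zero) |>.mp this
  subst hb
  have hp : x * p + 0 = 0 := by
    have : 2 * μ * m₂ / u ^ 5 * (x * p + 0) ^ 2 = 0 := by linarith
    rw [mul_eq_zero, or_iff_right (by positivity)] at this
    exact pow_eq_zero_iff (two_ne_zero) |>.mp this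
  have hq : y * q + 0 = 0 := by
    have : 2 * μ * m₃ / v ^ 5 * (y * q + 0) ^ 2 = 0 := by linarith
    rw [mul_eq_zero, or_iff_right (by positivity)] at this
    exact pow_eq_zero_iff (two_ne_zero) |>.mp this
  rw [add_zero] at hp hq
  exact ⟨rfl, (mul_eq_zero.mp hp).resolve_left h.hx.ne',
    (mul_eq_zero.mp hq).resolve_left h.y_ne_zero⟩

/-- The symmetric part of the kernel equations after elimination of the masses. -/
theorem even_eqs (h : KiteStress μ m₂ m₃ x y u v L) {b p q : ℝ}
    (h₂ : 2 * μ * (3 * x * (x * p + b) / u ^ 5 - (1 / u ^ 3 - L) * p)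
      + m₃ * (3 / (x - y) ^ 3 - (1 / (x - y) ^ 3 - L)) * (p - q) = 0)
    (h₃ : 2 * μ * (3 * y * (y * q + b) / v ^ 5 - (1 / v ^ 3 - L) * q)
      - m₂ * (3 / (x - y) ^ 3 - (1 / (x - y) ^ 3 - L)) * (p - q) = 0)
    (h₀ : μ * (3 / 4 * b - 2 * (1 / 8 - L) * b) + m₂ * (3 * (x * p + b) / u ^ 5 - (1 / u ^ 3 - L) * b)
      + m₃ * (3 * (y * q + b) / v ^ 5 - (1 / v ^ 3 - L) * b) = 0)
    (hS : 1 / 8 - L ≠ 0) :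
    3 * x * (x - y) * (1 / (x - y) ^ 3 - L) * ((x * p + b) / u ^ 5)
        - 3 * x * (1 / u ^ 3 - L) * ((p - q) / (x - y) ^ 3)
        + (1 / u ^ 3 - L) * (1 / (x - y) ^ 3 - L) * (y * p - x * q) = 0 ∧
      3 * y * (x - y) * (1 / (x - y) ^ 3 - L) * ((y * q + b) / v ^ 5)
        - 3 * y * (1 / v ^ 3 - L) * ((p - q) / (x - y) ^ 3)
        + (1 / v ^ 3 - L) * (1 / (x - y) ^ 3 - L) * (y * p - x * q) = 0 ∧
      b * (1 / (x - y) ^ 3 - L) * (x - y) / 8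
        = (1 / u ^ 3 - L) * x * ((y * q + b) / v ^ 5)
          - (1 / v ^ 3 - L) * y * ((x * p + b) / u ^ 5) := by
  have hμ : 2 * μ ≠ 0 := mul_ne_zero two_ne_zero h.hμ.ne'
  have e0 : μ * b / 4 + m₂ * (x * p + b) / u ^ 5 + m₃ * (y * q + b) / v ^ 5 = 0 := by
    linear_combination h₀ / 3 + b / 3 * h.eq_im
  have e1 : 2 * μ * (1 / 8 - L) * y - m₂ * (1 / u ^ 3 - L) * (x - y) = 0 := by
    linear_combination y * h.eq_im - h.eq_re
  refine ⟨mul_left_cancel₀ hμ ?_, mul_left_cancel₀ hμ ?_,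
    mul_left_cancel₀ hμ (mul_left_cancel₀ hS ?_)⟩
  · linear_combination (1 / (x - y) ^ 3 - L) * (x - y) * h₂
      - (3 * ((p - q) / (x - y) ^ 3) - (1 / (x - y) ^ 3 - L) * (p - q)) * h.eq_two
  · linear_combination (1 / (x - y) ^ 3 - L) * (x - y) * h₃
      - (3 * ((p - q) / (x - y) ^ 3) - (1 / (x - y) ^ 3 - L) * (p - q)) * h.eq_three
  · linear_combination (1 / u ^ 3 - L) * (1 / v ^ 3 - L) * (x - y) * e0
      + 2 * μ * b * (x - y) / 8 * h.product_eq
      + (1 / v ^ 3 - L) * ((x * p + b) / u ^ 5) * e1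
      - (1 / u ^ 3 - L) * ((y * q + b) / v ^ 5) * h.eq_one

/-- If the symmetric block of the Hessian is degenerate, then a `2 × 2` determinant vanishes. -/
theorem even_condition (h : KiteStress μ m₂ m₃ x y u v L) {b p q : ℝ}
    (h₂ : 2 * μ * (3 * x * (x * p + b) / u ^ 5 - (1 / u ^ 3 - L) * p)
      + m₃ * (3 / (x - y) ^ 3 - (1 / (x - y) ^ 3 - L)) * (p - q) = 0)
    (h₃ : 2 * μ * (3 * y * (y * q + b) / v ^ 5 - (1 / v ^ 3 - L) * q)
      - m₂ * (3 / (x - y) ^ 3 - (1 / (x - y) ^ 3 - L)) * (p - q) = 0)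
    (h₀ : μ * (3 / 4 * b - 2 * (1 / 8 - L) * b) + m₂ * (3 * (x * p + b) / u ^ 5 - (1 / u ^ 3 - L) * b)
      + m₃ * (3 * (y * q + b) / v ^ 5 - (1 / v ^ 3 - L) * b) = 0)
    (hS : 1 / 8 - L ≠ 0) (hG : 1 / (x - y) ^ 3 - L ≠ 0) (hl : y * p - x * q ≠ 0) :
    ((L * u ^ 5 - u ^ 2) * y ^ 2 + (v ^ 2 - L * v ^ 5) * x ^ 2
        + (x - y) * (8 * L - 1) * (x + y)) ^ 2
      = ((L * u ^ 5 - u ^ 2) * y + (v ^ 2 - L * v ^ 5) * x + (x - y) * (8 * L - 1)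
          + (x - y) * (x * y) * (1 - L * (x - y) ^ 3))
        * ((L * u ^ 5 - u ^ 2) * y ^ 3 + (v ^ 2 - L * v ^ 5) * x ^ 3
          + (x - y) * (8 * L - 1) * (x + y) ^ 2 - 3 * (x * y) ^ 2 * (x - y)) := by
  obtain ⟨e2, e3, e0⟩ := h.even_eqs h₂ h₃ h₀ hS
  have hpr := h.product_eq
  have hx := h.hx.ne'
  have hy := h.y_ne_zero
  have hu := h.hu.ne'
  have hv := h.hv.ne'
  have hg := (sub_pos.mpr h.hyx).ne'
  -- `c` and `s` are rescalings of `y p - x q` and `p - q`, in which the other unknowns are linear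
  -- with simple coefficients.
  obtain ⟨c, hc⟩ : ∃ c, c = -(y * p - x * q) / (3 * (x * y) * (x - y)) := ⟨_, rfl⟩
  obtain ⟨s, hs⟩ : ∃ s, s = -((p - q) / (x - y) ^ 3) / ((x - y) * (1 / (x - y) ^ 3 - L)) :=
    ⟨_, rfl⟩
  have hc0 : c ≠ 0 := by
    rw [hc]
    exact div_ne_zero (neg_ne_zero.mpr hl) (by positivity)
  have hl' : y * p - x * q = -(3 * (x * y) * (x - y) * c) := by
    rw [hc]
    field_simp
  have hD : (p - q) / (x - y) ^ 3 = -(s * ((x - y) * (1 / (x - y) ^ 3 - L))) := by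
    rw [hs, div_mul_cancel₀ _ (mul_ne_zero hg hG), neg_neg]
  have hpq : p - q = -((x - y) * (1 - L * (x - y) ^ 3) * s) := by
    have : p - q = (p - q) / (x - y) ^ 3 * (x - y) ^ 3 := by field_simp
    rw [this, hD]
    field_simp
  rw [hD, hl'] at e2 e3
  have f2 : (x * p + b) / u ^ 5 = (1 / u ^ 3 - L) * (c * y - s) := by
    refine mul_left_cancel₀ (mul_ne_zero (mul_ne_zero (mul_ne_zero three_ne_zero hx) hg) hG) ?_
    linear_combination e2
  have f3 : (y * q + b) / v ^ 5 = (1 / v ^ 3 - L) * (c * x - s) := by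
    refine mul_left_cancel₀ (mul_ne_zero (mul_ne_zero (mul_ne_zero three_ne_zero hy) hg) hG) ?_
    linear_combination e3
  have f0 : b = -((8 * L - 1) * (c * (x + y) - s)) := by
    rw [f2, f3] at e0
    refine mul_left_cancel₀ (mul_ne_zero hG hg) ?_
    linear_combination 8 * e0 - 8 * (x - y) * (c * (x + y) - s) * hpr
  have g2 : x * p + b = -((L * u ^ 5 - u ^ 2) * (c * y - s)) := by
    rw [div_eq_iff (pow_ne_zero 5 hu)] at f2
    rw [f2]
    field_simp
    ring
  have g3 : y * q + b = (v ^ 2 - L * v ^ 5) * (c * x - s) := by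
    rw [div_eq_iff (pow_ne_zero 5 hv)] at f3
    rw [f3]
    field_simp
  generalize L * u ^ 5 - u ^ 2 = α at *
  generalize v ^ 2 - L * v ^ 5 = β at *
  generalize hσ : 8 * L - 1 = σ at *
  generalize hτ : 1 - L * (x - y) ^ 3 = τ at *
  -- Consistency with the definitions of `s` and `c` gives a homogeneous `2 × 2` system. As `c ≠ 0`,
  -- its determinant vanishes.
  have i1 : s * (α * y + β * x + (x - y) * σ + (x - y) * (x * y) * τ)
      = c * (α * y ^ 2 + β * x ^ 2 + (x - y) * σ * (x + y)) := by
    linear_combination x * y * hpq - y * g2 + x * g3 - (x - y) * f0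
  have i2 : s * (α * y ^ 2 + β * x ^ 2 + (x - y) * σ * (x + y))
      = c * (α * y ^ 3 + β * x ^ 3 + (x - y) * σ * (x + y) ^ 2 - 3 * (x * y) ^ 2 * (x - y)) := by
    linear_combination x * y * hl' - y ^ 2 * g2 + x ^ 2 * g3 - (x - y) * (x + y) * f0
  generalize α * y + β * x + (x - y) * σ + (x - y) * (x * y) * τ = N0 at *
  generalize α * y ^ 2 + β * x ^ 2 + (x - y) * σ * (x + y) = N1 at *
  generalize α * y ^ 3 + β * x ^ 3 + (x - y) * σ * (x + y) ^ 2 - 3 * (x * y) ^ 2 * (x - y) = N2 at *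
  refine mul_left_cancel₀ hc0 ?_
  linear_combination N0 * i2 - N1 * i1

/-- The antisymmetric block of the Hessian of a convex kite is nondegenerate. -/
theorem not_odd_of_neg (h : KiteStress μ m₂ m₃ x y u v L) (hy : y < 0)
    (hodd : L * (y * u ^ 5 - x * v ^ 5) = (x - y) * (2 + x * y)) : False := by
  obtain ⟨h1, h2, h3⟩ := h.convex_signs hy
  have hx := h.hx
  have hu := h.hu
  have hv := h.hv
  have hu2 : u < 2 := lt_of_one_div_cube_lt two_pos (by norm_num at *; linarith)
  have hv2 : v < 2 := lt_of_one_div_cube_lt two_pos (by norm_num at *; linarith)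
  obtain ⟨z, rfl⟩ : ∃ z, y = -z := ⟨-y, by ring⟩
  have hz : 0 < z := by linarith
  have hU := h.hu2
  have hV := h.hv2
  have hx3 : x ^ 2 < 3 := by nlinarith
  have hz3 : z ^ 2 < 3 := by nlinarith
  have hpos : 0 < L * (z * u ^ 5 + x * v ^ 5) := mul_pos (by linarith) (by positivity)
  -- Positivity of the left side gives `x z > 2`, hence `x², z² > 4/3` and `u⁵, v⁵ > 8`. With `L >
  -- 1/8` the left side exceeds `x + z`, while `x z < 3` keeps the right side below it.
  have hxz : 2 < x * z := by
    have : 0 < (x + z) * (x * z - 2) := by linarith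
    have := pos_of_mul_pos_right this (by positivity)
    linarith
  have hxz3 : x * z < 3 := by nlinarith [sq_nonneg (x - z)]
  have h4 : 4 < x ^ 2 * z ^ 2 := by nlinarith
  have hx4 : 4 / 3 < x ^ 2 := by nlinarith
  have hz4 : 4 / 3 < z ^ 2 := by nlinarith
  have key : ∀ w : ℝ, 0 < w → 7 / 3 < w ^ 2 → 8 < w ^ 5 := by
    intro w hw hw2
    have hw1 : 3 / 2 < w := by nlinarith
    have hw4 : 49 / 9 < w ^ 4 := by nlinarith
    nlinarith
  have hU8 := key u hu (by linarith)
  have hV8 := key v hv (by nlinarith)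
  have : 8 * (z + x) < z * u ^ 5 + x * v ^ 5 := by nlinarith
  nlinarith

/-- If both blocks of the Hessian are degenerate, then `kitePoly` vanishes. -/
theorem kitePoly_eq_zero (h : KiteStress μ m₂ m₃ x y u v L) (hy : 0 < y)
    (hodd : L * (y * u ^ 5 - x * v ^ 5) = (x - y) * (2 + x * y))
    (heven : ((L * u ^ 5 - u ^ 2) * y ^ 2 + (v ^ 2 - L * v ^ 5) * x ^ 2
        + (x - y) * (8 * L - 1) * (x + y)) ^ 2
      = ((L * u ^ 5 - u ^ 2) * y + (v ^ 2 - L * v ^ 5) * x + (x - y) * (8 * L - 1)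
          + (x - y) * (x * y) * (1 - L * (x - y) ^ 3))
        * ((L * u ^ 5 - u ^ 2) * y ^ 3 + (v ^ 2 - L * v ^ 5) * x ^ 3
          + (x - y) * (8 * L - 1) * (x + y) ^ 2 - 3 * (x * y) ^ 2 * (x - y))) :
    kitePoly x y (u ^ 5) (v ^ 5) = 0 := by
  have hx := h.hx
  have hU := h.hu2
  have hV := h.hv2
  have hg := sub_pos.mpr h.hyx
  have hDpos : y * u ^ 5 - x * v ^ 5 ≠ 0 := by
    intro h0
    rw [h0, mul_zero] at hodd
    have : 0 < (x - y) * (2 + x * y) := by positivity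
    linarith
  set D := y * u ^ 5 - x * v ^ 5 with hDd
  set n1 := u ^ 5 * y ^ 2 - v ^ 5 * x ^ 2 + 8 * (x - y) * (x + y) with hn1
  set n2 := u ^ 5 * y ^ 3 - v ^ 5 * x ^ 3 + 8 * (x - y) * (x + y) ^ 2 with hn2
  have e0 : (L * u ^ 5 - u ^ 2) * y + (v ^ 2 - L * v ^ 5) * x + (x - y) * (8 * L - 1)
        + (x - y) * (x * y) * (1 - L * (x - y) ^ 3)
      = (x - y) * (2 + x * y + L * (8 - x * y * (x - y) ^ 3)) := by
    linear_combination hodd - y * hU + x * hV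
  have e1 : (L * u ^ 5 - u ^ 2) * y ^ 2 + (v ^ 2 - L * v ^ 5) * x ^ 2
      + (x - y) * (8 * L - 1) * (x + y) = L * n1 := by
    linear_combination -y ^ 2 * hU + x ^ 2 * hV
  have e2 : (L * u ^ 5 - u ^ 2) * y ^ 3 + (v ^ 2 - L * v ^ 5) * x ^ 3
        + (x - y) * (8 * L - 1) * (x + y) ^ 2 - 3 * (x * y) ^ 2 * (x - y)
      = L * n2 - (x - y) * (x * y) * (1 + 2 * (x * y)) := by
    linear_combination -y ^ 3 * hU + x ^ 3 * hV
  rw [e0, e1, e2] at heven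
  have hkey : (2 + x * y) * n1 ^ 2 = (D + (x - y) * (8 - x * y * (x - y) ^ 3))
      * ((2 + x * y) * n2 - x * y * (1 + 2 * (x * y)) * D) := by
    have hc : (x - y) ^ 2 * (2 + x * y) ≠ 0 := by positivity
    refine mul_left_cancel₀ hc ?_
    -- The antisymmetric condition determines `L`, which is substituted into the determinant.
    have hL : L = (x - y) * (2 + x * y) / D := by
      rw [eq_div_iff hDpos]
      exact hodd
    rw [hL] at heven
    field_simp at heven
    linear_combination (x - y) ^ 2 * (2 + x * y) * heven
  have hP : x * y ≠ 0 := by positivity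
  refine mul_left_cancel₀ hP ?_
  rw [mul_zero]
  have : x * y * kitePoly x y (u ^ 5) (v ^ 5)
      = (2 + x * y) * ((D + (x - y) * (8 - x * y * (x - y) ^ 3)) * n2 - n1 ^ 2)
        - x * y * (1 + 2 * (x * y)) * D * (D + (x - y) * (8 - x * y * (x - y) ^ 3)) := by
    rw [kitePoly, hDd, hn1, hn2]
    ring
  rw [this]
  linear_combination -hkey

/-- The two blocks of the Hessian of a concave kite which is not equilateral are not both
degenerate. -/
theorem not_odd_and_even_of_pos (h : KiteStress μ m₂ m₃ x y u v L) (hy : 0 < y)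
    (hne : ¬ (x ^ 2 = 3 ∧ x * y = 1))
    (hodd : L * (y * u ^ 5 - x * v ^ 5) = (x - y) * (2 + x * y))
    (heven : ((L * u ^ 5 - u ^ 2) * y ^ 2 + (v ^ 2 - L * v ^ 5) * x ^ 2
        + (x - y) * (8 * L - 1) * (x + y)) ^ 2
      = ((L * u ^ 5 - u ^ 2) * y + (v ^ 2 - L * v ^ 5) * x + (x - y) * (8 * L - 1)
          + (x - y) * (x * y) * (1 - L * (x - y) ^ 3))
        * ((L * u ^ 5 - u ^ 2) * y ^ 3 + (v ^ 2 - L * v ^ 5) * x ^ 3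
          + (x - y) * (8 * L - 1) * (x + y) ^ 2 - 3 * (x * y) ^ 2 * (x - y))) : False := by
  obtain ⟨h1, h2, h3, h4⟩ := h.concave_signs hy
  have hx := h.hx
  have hu := h.hu
  have hv := h.hv
  have hU := h.hu2
  have hV := h.hv2
  have hg := sub_pos.mpr h.hyx
  have hprod : (L - 1 / 8) * (1 / (x - y) ^ 3 - L) = (L - 1 / u ^ 3) * (1 / v ^ 3 - L) := by
    linear_combination -h.product_eq
  have hDpos : 0 < y * u ^ 5 - x * v ^ 5 := by
    have : 0 < L * (y * u ^ 5 - x * v ^ 5) := by rw [hodd]; positivity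
    exact pos_of_mul_pos_right this (by linarith)
  -- From `hodd` and `L > 1/8`.
  have hD : y * u ^ 5 - x * v ^ 5 < 8 * (x - y) * (2 + x * y) := by nlinarith
  have hzero := h.kitePoly_eq_zero hy hodd heven
  clear heven
  -- In `hprod` all four factors are positive, so comparing `u` with 2 decides how `v` compares with
  -- `x - y`.
  rcases lt_trichotomy u 2 with hu2 | hu2 | hu2
  · have hu8 : 1 / 8 < 1 / u ^ 3 := by
      have := one_div_lt_one_div_of_lt (pow_pos hu 3)
        (pow_lt_pow_left₀ hu2 hu.le (n := 3) (by norm_num))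
      norm_num at this ⊢
      linarith
    have hlt : v < x - y := by
      refine lt_of_one_div_cube_lt hg ?_
      by_contra! hle
      have : (L - 1 / u ^ 3) * (1 / v ^ 3 - L) < (L - 1 / 8) * (1 / (x - y) ^ 3 - L) :=
        mul_lt_mul (by linarith) (by linarith) (by linarith) (by linarith)
      linarith
    have := kitePoly_pos hx hy (by nlinarith) (by nlinarith) hu hU hv hV
    linarith
  · subst hu2
    have hgv : v = x - y := by
      refine (eq_of_one_div_cube_eq hg hv ?_).symm
      have h8 : (2 : ℝ) ^ 3 = 8 := by norm_num
      rw [h8] at hprod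
      have := mul_left_cancel₀ (sub_pos.mpr h1).ne' hprod
      linarith
    exact hne ⟨by linarith, by rw [hgv] at hV; nlinarith⟩
  · have hu8 : 1 / u ^ 3 < 1 / 8 := by
      have := one_div_lt_one_div_of_lt (by norm_num)
        (pow_lt_pow_left₀ hu2 two_pos.le (n := 3) (by norm_num))
      norm_num at this ⊢
      linarith
    have hlt : x - y < v := by
      refine lt_of_one_div_cube_lt hv ?_
      by_contra! hle
      have : (L - 1 / 8) * (1 / (x - y) ^ 3 - L) < (L - 1 / u ^ 3) * (1 / v ^ 3 - L) :=
        mul_lt_mul (by linarith) (by linarith) (by linarith) (by linarith)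
      linarith
    have := kitePoly_neg hx hy (by nlinarith) (by nlinarith) hu hU hv hV
      (lt_of_one_div_cube_lt two_pos (by norm_num at *; linarith)) hD
    linarith

end KiteStress

/-! ### Translation invariant equations and similarities -/

/-- The residual of the central configuration equations in translation invariant form. -/
def stressVec (m : Fin N → ℝ) (L : ℝ) (x : Fin N → ℂ) (k : Fin N) : ℂ :=
  ∑ j ∈ Finset.univ.erase k, (m j * (1 / ‖x k - x j‖ ^ 3 - L)) • (x k - x j)

/-- The residual of the equations for the kernel of the Hessian in translation invariant form, on
displacements orthogonal to the configuration. -/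
def kernelVec (m : Fin N → ℝ) (L : ℝ) (x u : Fin N → ℂ) (k : Fin N) : ℂ :=
  ∑ j ∈ Finset.univ.erase k, m j •
    ((3 * inner ℝ (x k - x j) (u k - u j) / ‖x k - x j‖ ^ 5) • (x k - x j)
      - (1 / ‖x k - x j‖ ^ 3 - L) • (u k - u j))

/-- Trades absolute positions for differences, so that the equations can be moved to the normal
form, which need not be centered. -/
theorem sum_erase_mass_smul_sub {m : Fin N → ℝ} (x : centeredSpace m) (k : Fin N) :
    ∑ j ∈ Finset.univ.erase k, m j • (x.1 k - x.1 j) = (∑ j, m j) • x.1 k := by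
  rw [← Finset.add_sum_erase (Finset.univ) (fun j => m j) (Finset.mem_univ k), add_smul,
    Finset.sum_smul]
  simp only [smul_sub, Finset.sum_sub_distrib]
  have h := sum_mass_smul_eq_zero x
  rw [← Finset.add_sum_erase (Finset.univ) (fun j => m j • x.1 j) (Finset.mem_univ k)] at h
  rw [← eq_neg_iff_add_eq_zero.mpr h |> neg_eq_iff_eq_neg.mpr]
  abel

theorem IsCentralWith.stressVec_eq_zero {m : Fin N → ℝ} (hm : ∀ k, 0 < m k) {lam : ℝ}
    {x : centeredSpace m} (h : IsCentralWith m lam x.1) (k : Fin N) :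
    stressVec m (lam / ∑ j, m j) x.1 k = 0 := by
  have hM : ∑ k, m k ≠ 0 := (Finset.sum_pos (fun k _ => hm k) ⟨k, Finset.mem_univ k⟩).ne'
  have h1 := h.sum_eq k
  have h2 := sum_erase_mass_smul_sub x k
  refine (smul_eq_zero.mp ?_).resolve_left (hm k).ne'
  calc m k • stressVec m (lam / ∑ j, m j) x.1 k
      = ∑ j ∈ Finset.univ.erase k, (m j * m k) • ((1 / ‖x.1 k - x.1 j‖ ^ 3) • (x.1 k - x.1 j))
        - (m k * (lam / ∑ j, m j)) • ∑ j ∈ Finset.univ.erase k, m j • (x.1 k - x.1 j) := by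
        rw [stressVec, Finset.smul_sum, Finset.smul_sum, ← Finset.sum_sub_distrib]
        exact Finset.sum_congr rfl fun j _ => by module
    _ = 0 := by
        rw [h1, h2, smul_smul, mul_assoc, div_mul_cancel₀ _ hM, mul_comm, sub_self]

theorem kernelVec_eq_zero {m : Fin N → ℝ} (hm : ∀ k, 0 < m k) {lam : ℝ} {x u : centeredSpace m}
    (hu : massInner m x.1 u.1 = 0) {k : Fin N} (h : hessVec m lam x.1 u.1 k = 0) :
    kernelVec m (lam / ∑ j, m j) x.1 u.1 k = 0 := by
  have hM : ∑ k, m k ≠ 0 := (Finset.sum_pos (fun k _ => hm k) ⟨k, Finset.mem_univ k⟩).ne'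
  have h2 := sum_erase_mass_smul_sub u k
  rw [hessVec, hu, mul_zero, zero_div, zero_mul, zero_smul, sub_zero] at h
  refine (smul_eq_zero.mp ?_).resolve_left (hm k).ne'
  calc m k • kernelVec m (lam / ∑ j, m j) x.1 u.1 k
      = forceHessVec m x.1 u.1 k
        + (m k * (lam / ∑ j, m j)) • ∑ j ∈ Finset.univ.erase k, m j • (u.1 k - u.1 j) := by
        rw [kernelVec, forceHessVec, Finset.smul_sum, Finset.smul_sum, ← Finset.sum_add_distrib]
        exact Finset.sum_congr rfl fun j _ => by module
    _ = 0 := by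
        rw [h2, smul_smul, mul_assoc, div_mul_cancel₀ _ hM, mul_comm (m k), h]

theorem sum_erase_perm {M : Type*} [AddCommMonoid M] (σ : Equiv.Perm (Fin N)) (k : Fin N)
    (f : Fin N → M) :
    ∑ j ∈ Finset.univ.erase (σ k), f j = ∑ j ∈ Finset.univ.erase k, f (σ j) := by
  refine (Finset.sum_equiv σ ?_ fun _ _ => rfl).symm
  simp

/-- Inverse cubes of distances scale by `‖ω‖⁻³`, which is absorbed by replacing `L` with `L ‖ω‖³`.
-/
theorem stressVec_similar {m : Fin N → ℝ} {L : ℝ} {x ρ : Fin N → ℂ} (σ : Equiv.Perm (Fin N))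
    {c ω : ℂ} (hω : ω ≠ 0) (hx : ∀ k, x (σ k) = c + ω * ρ k) {k : Fin N}
    (h : stressVec m L x (σ k) = 0) : stressVec (m ∘ σ) (L * ‖ω‖ ^ 3) ρ k = 0 := by
  have hn : ‖ω‖ ≠ 0 := norm_ne_zero_iff.mpr hω
  have hc : ω / (‖ω‖ : ℂ) ^ 3 ≠ 0 := div_ne_zero hω (by exact_mod_cast pow_ne_zero 3 hn)
  refine (mul_eq_zero.mp ?_).resolve_left hc
  rw [← h, stressVec, stressVec, sum_erase_perm, Finset.mul_sum]
  refine Finset.sum_congr rfl fun j _ => ?_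
  have hd : x (σ k) - x (σ j) = ω * (ρ k - ρ j) := by rw [hx, hx]; ring
  have he : 1 / ‖x (σ k) - x (σ j)‖ ^ 3 - L
      = (1 / ‖ω‖ ^ 3) * (1 / ‖ρ k - ρ j‖ ^ 3 - L * ‖ω‖ ^ 3) := by
    rw [hd, norm_mul, mul_pow, mul_sub, one_div_mul_one_div]
    field_simp
  rw [he, hd]
  simp only [Complex.real_smul, Function.comp]
  push_cast
  ring

theorem inner_mul_mul (ω a b : ℂ) : inner ℝ (ω * a) (ω * b) = ‖ω‖ ^ 2 * inner ℝ a b := by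
  rw [Complex.inner, Complex.inner, ← Complex.normSq_eq_norm_sq, Complex.normSq_apply]
  simp
  ring

theorem kernelVec_similar {m : Fin N → ℝ} {L : ℝ} {x ρ u v : Fin N → ℂ} (σ : Equiv.Perm (Fin N))
    {c ω : ℂ} (hω : ω ≠ 0) (hx : ∀ k, x (σ k) = c + ω * ρ k) (hu : ∀ k, u (σ k) = ω * v k)
    {k : Fin N} (h : kernelVec m L x u (σ k) = 0) :
    kernelVec (m ∘ σ) (L * ‖ω‖ ^ 3) ρ v k = 0 := by
  have hn : ‖ω‖ ≠ 0 := norm_ne_zero_iff.mpr hω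
  have hc : ω / (‖ω‖ : ℂ) ^ 3 ≠ 0 := div_ne_zero hω (by exact_mod_cast pow_ne_zero 3 hn)
  refine (mul_eq_zero.mp ?_).resolve_left hc
  rw [← h, kernelVec, kernelVec, sum_erase_perm, Finset.mul_sum]
  refine Finset.sum_congr rfl fun j _ => ?_
  have hd : x (σ k) - x (σ j) = ω * (ρ k - ρ j) := by rw [hx, hx]; ring
  have hd' : u (σ k) - u (σ j) = ω * (v k - v j) := by rw [hu, hu]; ring
  have he : 1 / ‖x (σ k) - x (σ j)‖ ^ 3 - L
      = (1 / ‖ω‖ ^ 3) * (1 / ‖ρ k - ρ j‖ ^ 3 - L * ‖ω‖ ^ 3) := by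
    rw [hd, norm_mul, mul_pow, mul_sub, one_div_mul_one_div]
    field_simp
  have he' : 3 * inner ℝ (x (σ k) - x (σ j)) (u (σ k) - u (σ j)) / ‖x (σ k) - x (σ j)‖ ^ 5
      = (1 / ‖ω‖ ^ 3) * (3 * inner ℝ (ρ k - ρ j) (v k - v j) / ‖ρ k - ρ j‖ ^ 5) := by
    rw [hd, hd', norm_mul, mul_pow, inner_mul_mul]
    field_simp
  rw [he, he', hd, hd']
  simp only [Complex.real_smul, Function.comp]
  push_cast
  ring

/-! ### The equations in the coordinates of the kite -/

/-- The kite with two particles at `± i` and two at the real points `x`, `y`. -/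
def kite (x y : ℝ) : Fin 4 → ℂ := ![Complex.I, -Complex.I, x, y]

theorem sum_erase_zero {M : Type*} [AddCommMonoid M] (f : Fin 4 → M) :
    ∑ j ∈ Finset.univ.erase 0, f j = f 1 + f 2 + f 3 := by
  rw [show (Finset.univ.erase 0 : Finset (Fin 4)) = {1, 2, 3} by decide,
    Finset.sum_insert (by decide), Finset.sum_insert (by decide), Finset.sum_singleton, add_assoc]

theorem sum_erase_one {M : Type*} [AddCommMonoid M] (f : Fin 4 → M) :
    ∑ j ∈ Finset.univ.erase 1, f j = f 0 + f 2 + f 3 := by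
  rw [show (Finset.univ.erase 1 : Finset (Fin 4)) = {0, 2, 3} by decide,
    Finset.sum_insert (by decide), Finset.sum_insert (by decide), Finset.sum_singleton, add_assoc]

theorem sum_erase_two {M : Type*} [AddCommMonoid M] (f : Fin 4 → M) :
    ∑ j ∈ Finset.univ.erase 2, f j = f 0 + f 1 + f 3 := by
  rw [show (Finset.univ.erase 2 : Finset (Fin 4)) = {0, 1, 3} by decide,
    Finset.sum_insert (by decide), Finset.sum_insert (by decide), Finset.sum_singleton, add_assoc]

theorem sum_erase_three {M : Type*} [AddCommMonoid M] (f : Fin 4 → M) :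
    ∑ j ∈ Finset.univ.erase 3, f j = f 0 + f 1 + f 2 := by
  rw [show (Finset.univ.erase 3 : Finset (Fin 4)) = {0, 1, 2} by decide,
    Finset.sum_insert (by decide), Finset.sum_insert (by decide), Finset.sum_singleton, add_assoc]

section Norms

open Complex

theorem norm_I_sub_neg_I : ‖I - -I‖ = 2 := by
  rw [sub_neg_eq_add, ← two_mul, norm_mul, norm_I]
  norm_num

theorem norm_eq_sqrt_of_sq {z : ℂ} {a : ℝ} (h : z.re * z.re + z.im * z.im = a) : ‖z‖ = √a := by
  rw [← h, ← Complex.normSq_apply, Complex.normSq_eq_norm_sq, Real.sqrt_sq (norm_nonneg _)]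

theorem norm_I_sub_ofReal (x : ℝ) : ‖I - x‖ = √(1 + x ^ 2) :=
  norm_eq_sqrt_of_sq (by simp; ring)

theorem norm_neg_I_sub_ofReal (x : ℝ) : ‖-I - x‖ = √(1 + x ^ 2) :=
  norm_eq_sqrt_of_sq (by simp; ring)

theorem norm_ofReal_sub_ofReal {x y : ℝ} (h : y < x) : ‖(x : ℂ) - y‖ = x - y := by
  rw [← Complex.ofReal_sub, Complex.norm_real, Real.norm_of_nonneg (sub_pos.mpr h).le]

end Norms

theorem stressVec_kite {m : Fin 4 → ℝ} {x y L : ℝ} (hyx : y < x)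
    (h : ∀ k, stressVec m L (kite x y) k = 0) :
    m 2 * (1 / √(1 + x ^ 2) ^ 3 - L) * x + m 3 * (1 / √(1 + y ^ 2) ^ 3 - L) * y = 0 ∧
    2 * m 1 * (1 / 8 - L) + m 2 * (1 / √(1 + x ^ 2) ^ 3 - L)
      + m 3 * (1 / √(1 + y ^ 2) ^ 3 - L) = 0 ∧
    (m 0 + m 1) * (1 / √(1 + x ^ 2) ^ 3 - L) * x
      + m 3 * (1 / (x - y) ^ 3 - L) * (x - y) = 0 ∧
    (m 0 + m 1) * (1 / √(1 + y ^ 2) ^ 3 - L) * y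
      - m 2 * (1 / (x - y) ^ 3 - L) * (x - y) = 0 ∧
    (m 1 - m 0) * (1 / √(1 + x ^ 2) ^ 3 - L) = 0 ∧
    (m 1 - m 0) * (1 / √(1 + y ^ 2) ^ 3 - L) = 0 := by
  have h0 := h 0
  have h2 := h 2
  have h3 := h 3
  rw [stressVec, sum_erase_zero] at h0
  rw [stressVec, sum_erase_two] at h2
  rw [stressVec, sum_erase_three] at h3
  simp only [kite, Matrix.cons_val] at h0 h2 h3
  rw [norm_I_sub_neg_I, norm_I_sub_ofReal, norm_I_sub_ofReal] at h0
  rw [norm_sub_rev, norm_I_sub_ofReal, norm_sub_rev, norm_neg_I_sub_ofReal,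
    norm_ofReal_sub_ofReal hyx] at h2
  rw [norm_sub_rev, norm_I_sub_ofReal, norm_sub_rev, norm_neg_I_sub_ofReal, norm_sub_rev,
    norm_ofReal_sub_ofReal hyx] at h3
  generalize √(1 + x ^ 2) = u at *
  generalize √(1 + y ^ 2) = v at *
  rw [Complex.ext_iff] at h0 h2 h3
  simp only [Complex.add_re, Complex.add_im, Complex.smul_re, Complex.smul_im, Complex.sub_re,
    Complex.sub_im, Complex.neg_re, Complex.neg_im, Complex.I_re, Complex.I_im, Complex.ofReal_re,
    Complex.ofReal_im, Complex.zero_re, Complex.zero_im, smul_eq_mul] at h0 h2 h3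
  obtain ⟨a0, b0⟩ := h0
  obtain ⟨a2, b2⟩ := h2
  obtain ⟨a3, b3⟩ := h3
  refine ⟨?_, ?_, ?_, ?_, ?_, ?_⟩
  · linear_combination -a0
  · linear_combination b0
  · linear_combination a2
  · linear_combination a3
  · linear_combination b2
  · linear_combination b3

/-- The two particles off the axis of symmetry have equal masses. -/
theorem mass_eq_of_stressVec_kite {m : Fin 4 → ℝ} (hm : ∀ k, 0 < m k) {x y L : ℝ} (hyx : y < x)
    (h : ∀ k, stressVec m L (kite x y) k = 0) : m 1 = m 0 := by
  obtain ⟨h1, h2, h3, h4, h5, h6⟩ := stressVec_kite hyx h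
  -- With unequal masses all stresses vanish, so the four particles would be at mutual distance 2,
  -- impossible in a plane.
  by_contra hne
  have hg := sub_pos.mpr hyx
  have hux : 0 < √(1 + x ^ 2) := by positivity
  have hvx : 0 < √(1 + y ^ 2) := by positivity
  have hne := sub_ne_zero.mpr hne
  have hu := (mul_eq_zero.mp h5).resolve_left hne
  have hv := (mul_eq_zero.mp h6).resolve_left hne
  rw [hu, hv, mul_zero, mul_zero, add_zero, add_zero, mul_eq_zero,
    or_iff_right (by have := hm 1; positivity)] at h2
  rw [hu, mul_zero, zero_mul, zero_add, mul_eq_zero, or_iff_left hg.ne', mul_eq_zero,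
    or_iff_right (hm 3).ne'] at h3
  have e1 : √(1 + x ^ 2) = 2 := eq_of_one_div_cube_eq hux two_pos (by norm_num at *; linarith)
  have e2 : √(1 + y ^ 2) = 2 := eq_of_one_div_cube_eq hvx two_pos (by norm_num at *; linarith)
  have e3 : x - y = 2 := eq_of_one_div_cube_eq hg two_pos (by norm_num at *; linarith)
  rw [Real.sqrt_eq_iff_mul_self_eq (by positivity) two_pos.le] at e1 e2
  have e4 : (x - y) * (x + y) = 0 := by linear_combination e1 - e2
  have e5 := (mul_eq_zero.mp e4).resolve_left hg.ne'
  have e6 : x = 1 := by linarith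
  rw [e6] at e1
  norm_num at e1

theorem kiteStress_of_stressVec {m : Fin 4 → ℝ} (hm : ∀ k, 0 < m k) {x y L : ℝ} (hx : 0 < x)
    (hyx : y < x) (h : ∀ k, stressVec m L (kite x y) k = 0) :
    KiteStress (m 0) (m 2) (m 3) x y √(1 + x ^ 2) √(1 + y ^ 2) L := by
  obtain ⟨h1, h2, h3, h4, -, -⟩ := stressVec_kite hyx h
  rw [mass_eq_of_stressVec_kite hm hyx h] at h2 h3 h4
  exact
    { hμ := hm 0
      hm₂ := hm 2
      hm₃ := hm 3
      hx := hx
      hyx := hyx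
      hu := by positivity
      hu2 := Real.sq_sqrt (by positivity)
      hv := by positivity
      hv2 := Real.sq_sqrt (by positivity)
      eq_re := h1
      eq_im := h2
      eq_two := by linear_combination h3
      eq_three := by linear_combination h4 }

/-- Splits the equations by reflection parity. Subtracting the mean of particles 0 and 1 removes a
translation and gives the unknowns `a, b, p, q` of the two blocks. -/
theorem kernelVec_kite {m : Fin 4 → ℝ} {x y L : ℝ} (hyx : y < x) (h01 : m 1 = m 0)
    {w : Fin 4 → ℂ} (h : ∀ k, kernelVec m L (kite x y) w k = 0)
    {α β : Fin 4 → ℝ} (hα : ∀ k, α k = (w k).re) (hβ : ∀ k, β k = (w k).im) :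
    (2 * m 0 * (3 * (x * ((α 0 - α 1) / 2) + (β 2 - (β 0 + β 1) / 2)) / √(1 + x ^ 2) ^ 5
        - (1 / √(1 + x ^ 2) ^ 3 - L) * (β 2 - (β 0 + β 1) / 2))
      - m 3 * (1 / (x - y) ^ 3 - L) * ((β 2 - (β 0 + β 1) / 2) - (β 3 - (β 0 + β 1) / 2)) = 0 ∧
    2 * m 0 * (3 * (y * ((α 0 - α 1) / 2) + (β 3 - (β 0 + β 1) / 2)) / √(1 + y ^ 2) ^ 5
        - (1 / √(1 + y ^ 2) ^ 3 - L) * (β 3 - (β 0 + β 1) / 2))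
      + m 2 * (1 / (x - y) ^ 3 - L) * ((β 2 - (β 0 + β 1) / 2) - (β 3 - (β 0 + β 1) / 2)) = 0) ∧
    2 * m 0 * (3 * x * (x * (α 2 - (α 0 + α 1) / 2) + (β 0 - β 1) / 2) / √(1 + x ^ 2) ^ 5
        - (1 / √(1 + x ^ 2) ^ 3 - L) * (α 2 - (α 0 + α 1) / 2))
      + m 3 * (3 / (x - y) ^ 3 - (1 / (x - y) ^ 3 - L))
        * ((α 2 - (α 0 + α 1) / 2) - (α 3 - (α 0 + α 1) / 2)) = 0 ∧
    2 * m 0 * (3 * y * (y * (α 3 - (α 0 + α 1) / 2) + (β 0 - β 1) / 2) / √(1 + y ^ 2) ^ 5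
        - (1 / √(1 + y ^ 2) ^ 3 - L) * (α 3 - (α 0 + α 1) / 2))
      - m 2 * (3 / (x - y) ^ 3 - (1 / (x - y) ^ 3 - L))
        * ((α 2 - (α 0 + α 1) / 2) - (α 3 - (α 0 + α 1) / 2)) = 0 ∧
    m 0 * (3 / 4 * ((β 0 - β 1) / 2) - 2 * (1 / 8 - L) * ((β 0 - β 1) / 2))
      + m 2 * (3 * (x * (α 2 - (α 0 + α 1) / 2) + (β 0 - β 1) / 2) / √(1 + x ^ 2) ^ 5
        - (1 / √(1 + x ^ 2) ^ 3 - L) * ((β 0 - β 1) / 2))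
      + m 3 * (3 * (y * (α 3 - (α 0 + α 1) / 2) + (β 0 - β 1) / 2) / √(1 + y ^ 2) ^ 5
        - (1 / √(1 + y ^ 2) ^ 3 - L) * ((β 0 - β 1) / 2)) = 0 := by
  have hg : (x - y) ^ 2 / (x - y) ^ 5 = 1 / (x - y) ^ 3 := by
    have := (sub_pos.mpr hyx).ne'
    field_simp
  have h0 := h 0
  have h1 := h 1
  have h2 := h 2
  have h3 := h 3
  rw [kernelVec, sum_erase_zero] at h0
  rw [kernelVec, sum_erase_one] at h1
  rw [kernelVec, sum_erase_two] at h2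
  rw [kernelVec, sum_erase_three] at h3
  simp only [kite, Matrix.cons_val] at h0 h1 h2 h3
  simp only [norm_I_sub_neg_I, norm_I_sub_ofReal] at h0
  simp only [norm_sub_rev (-Complex.I) Complex.I, norm_I_sub_neg_I, norm_neg_I_sub_ofReal] at h1
  simp only [norm_sub_rev (x : ℂ) (-Complex.I), norm_sub_rev (x : ℂ) (Complex.I),
    norm_I_sub_ofReal, norm_neg_I_sub_ofReal, norm_ofReal_sub_ofReal hyx] at h2
  simp only [norm_sub_rev (y : ℂ) (-Complex.I), norm_sub_rev (y : ℂ) (Complex.I),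
    norm_sub_rev (y : ℂ) x,
    norm_I_sub_ofReal, norm_neg_I_sub_ofReal, norm_ofReal_sub_ofReal hyx] at h3
  generalize √(1 + x ^ 2) = u at *
  generalize √(1 + y ^ 2) = v at *
  rw [Complex.ext_iff] at h0 h1 h2 h3
  simp only [Complex.inner, Complex.mul_re,
    map_sub, map_neg, Complex.conj_I, Complex.conj_ofReal,
    Complex.add_re, Complex.add_im, Complex.smul_re, Complex.smul_im, Complex.sub_re,
    Complex.sub_im, Complex.neg_re, Complex.neg_im, Complex.I_re, Complex.I_im, Complex.ofReal_re,
    Complex.ofReal_im, Complex.zero_re, Complex.zero_im, smul_eq_mul, ← hα, ← hβ, h01]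
    at h0 h1 h2 h3
  obtain ⟨-, b0⟩ := h0
  obtain ⟨-, b1⟩ := h1
  obtain ⟨a2, b2⟩ := h2
  obtain ⟨a3, b3⟩ := h3
  refine ⟨⟨?_, ?_⟩, ?_, ?_, ?_⟩
  · linear_combination b2
  · linear_combination b3
  · linear_combination a2 - 3 * m 3 * (α 2 - α 3) * hg
  · linear_combination a3 + 3 * m 2 * (α 2 - α 3) * hg
  · linear_combination (b0 - b1) / 2

/-! ### Normal form of a kite -/

theorem IsKite.exists_similar {r : Fin 4 → ℂ} (h : IsKite r) (hr : CollisionFree r) :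
    ∃ (σ : Equiv.Perm (Fin 4)) (c ω : ℂ) (x y : ℝ), ω ≠ 0 ∧ ∀ k, r (σ k) = c + ω * kite x y k := by
  obtain ⟨p, w, σ, hw, h1, h2, h3⟩ := h
  set S := AffineSubspace.mk' p (Submodule.span ℝ {w}) with hS
  set q : ℂ := ((EuclideanGeometry.orthogonalProjection S (r (σ 0)) : S) : ℂ) with hq
  have hqS : q ∈ S := EuclideanGeometry.orthogonalProjection_mem _
  have hn : r (σ 0) - q ∈ S.directionᗮ :=
    EuclideanGeometry.vsub_orthogonalProjection_mem_direction_orthogonal S _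
  rw [EuclideanGeometry.reflection_apply', ← hq] at h1
  simp only [vsub_eq_sub, vadd_eq_add] at h1
  set n := r (σ 0) - q with hnd
  have hn0 : n ≠ 0 := by
    intro h0
    have hne := hr (σ 0) (σ 1) (σ.injective.ne (by decide))
    apply hne
    rw [← h1, sub_eq_zero.mp h0]
    ring
  have hwn : inner ℝ w n = 0 := by
    rw [Submodule.mem_orthogonal] at hn
    refine hn w ?_
    rw [hS, AffineSubspace.direction_mk']
    exact Submodule.mem_span_singleton_self w
  have hreal : ∃ z : ℝ, w = z * (-Complex.I * n) := by
    have hnn : Complex.normSq n ≠ 0 := Complex.normSq_eq_zero.not.mpr hn0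
    rw [Complex.normSq_apply] at hnn
    obtain ⟨z, hz⟩ : ∃ z : ℝ, z * (n.re * n.re + n.im * n.im) = w.re * n.im - w.im * n.re :=
      ⟨_, div_mul_cancel₀ _ hnn⟩
    have hwn' : n.re * w.re + n.im * w.im = 0 := by
      rw [Complex.inner] at hwn
      simpa [mul_comm] using hwn
    refine ⟨z, Complex.ext ?_ ?_⟩
    · simp only [Complex.re_ofReal_mul, neg_mul, Complex.neg_re, Complex.I_mul_re, neg_neg]
      refine mul_left_cancel₀ hnn ?_
      linear_combination n.re * hwn' - n.im * hz
    · simp only [Complex.im_ofReal_mul, neg_mul, Complex.neg_im, Complex.I_mul_im]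
      refine mul_left_cancel₀ hnn ?_
      linear_combination n.im * hwn' + n.re * hz
  obtain ⟨z, hz⟩ := hreal
  have hline : ∀ a ∈ S, ∃ t : ℝ, a = q + (-Complex.I * n) * t := by
    intro a ha
    have hd : a -ᵥ q ∈ S.direction := AffineSubspace.vsub_mem_direction ha hqS
    rw [hS, AffineSubspace.direction_mk', Submodule.mem_span_singleton] at hd
    obtain ⟨t, ht⟩ := hd
    refine ⟨t * z, ?_⟩
    rw [vsub_eq_sub] at ht
    rw [← sub_eq_iff_eq_add', ← ht, Complex.real_smul, hz]
    push_cast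
    ring
  obtain ⟨x, hx⟩ := hline _ h2
  obtain ⟨y, hy⟩ := hline _ h3
  -- `q` is the midpoint of the mirror pair and `n` half of their difference; the factor `-i` sends
  -- `±i` to `±n`.
  refine ⟨σ, q, -Complex.I * n, x, y, mul_ne_zero (neg_ne_zero.mpr Complex.I_ne_zero) hn0, ?_⟩
  have hI : -Complex.I * n * Complex.I = n := by
    linear_combination -n * Complex.I_mul_I
  intro k
  fin_cases k
  · simp only [kite, Fin.zero_eta, Matrix.cons_val]
    rw [hI, hnd]
    ring
  · simp only [kite, Fin.mk_one, Matrix.cons_val]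
    rw [mul_neg, hI, ← h1, hnd]
    ring
  · simpa [kite] using hx
  · simpa [kite] using hy

theorem kite_swap (x y : ℝ) (k : Fin 4) : kite x y (Equiv.swap 2 3 k) = kite y x k := by
  fin_cases k
  · rfl
  · rfl
  · simp [kite]
  · simp [kite]

theorem kite_neg (x y : ℝ) (k : Fin 4) : kite x y (Equiv.swap 0 1 k) = -kite (-x) (-y) k := by
  fin_cases k
  · simp [kite]
  · simp [kite]
  · rw [show (Equiv.swap (0 : Fin 4) 1) ⟨2, by norm_num⟩ = 2 by decide]
    simp [kite]
  · rw [show (Equiv.swap (0 : Fin 4) 1) ⟨3, by norm_num⟩ = 3 by decide]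
    simp [kite]

/-- A kite in normal form. -/
theorem IsKite.exists_similar_pos {r : Fin 4 → ℂ} (h : IsKite r) (hr : CollisionFree r) :
    ∃ (σ : Equiv.Perm (Fin 4)) (c ω : ℂ) (x y : ℝ), ω ≠ 0 ∧ 0 < x ∧ y < x ∧
      ∀ k, r (σ k) = c + ω * kite x y k := by
  obtain ⟨σ, c, ω, x, y, hω, hk⟩ := h.exists_similar hr
  have hxy : ∃ (σ : Equiv.Perm (Fin 4)) (x y : ℝ), y < x ∧ ∀ k, r (σ k) = c + ω * kite x y k := by
    rcases lt_trichotomy x y with hlt | heq | hlt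
    · refine ⟨(Equiv.swap 2 3).trans σ, y, x, hlt, fun k => ?_⟩
      rw [Equiv.trans_apply, hk, kite_swap]
    · refine absurd ?_ (hr (σ 2) (σ 3) (σ.injective.ne (by decide)))
      rw [hk, hk, heq]
      rfl
    · exact ⟨σ, x, y, hlt, hk⟩
  obtain ⟨σ, x, y, hlt, hk⟩ := hxy
  rcases lt_or_ge 0 x with hx | hx
  · exact ⟨σ, c, ω, x, y, hω, hx, hlt, hk⟩
  -- If `y < x ≤ 0`, a half turn replaces `x, y` by `-y, -x`, and `-y > 0`.
  · refine ⟨(Equiv.swap 2 3).trans ((Equiv.swap 0 1).trans σ), c, -ω, -y, -x, neg_ne_zero.mpr hω,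
      by linarith, by linarith, fun k => ?_⟩
    rw [Equiv.trans_apply, Equiv.trans_apply, hk, kite_neg, kite_swap]
    ring

/-- A concave kite with `x = √3`, `y = 1 / √3` is equilateral. -/
theorem isEquilateral_of_similar {r : Fin 4 → ℂ} {σ : Equiv.Perm (Fin 4)} {c ω : ℂ} {x y : ℝ}
    (hx : 0 < x) (hk : ∀ k, r (σ k) = c + ω * kite x y k) (h3 : x ^ 2 = 3) (hxy : x * y = 1) :
    IsEquilateral r := by
  have hd : ∀ j k, dist (r (σ j)) (r (σ k)) = ‖ω‖ * ‖kite x y j - kite x y k‖ := by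
    intro j k
    rw [hk, hk, dist_eq_norm, ← norm_mul]
    ring_nf
  have h4 : √(1 + x ^ 2) = 2 := by
    rw [h3, Real.sqrt_eq_iff_mul_self_eq (by norm_num) (by norm_num)]
    norm_num
  have h01 : ‖kite x y 0 - kite x y 1‖ = 2 := norm_I_sub_neg_I
  have h12 : ‖kite x y 1 - kite x y 2‖ = 2 := (norm_neg_I_sub_ofReal x).trans h4
  have h20 : ‖kite x y 2 - kite x y 0‖ = 2 := (norm_sub_rev _ _).trans ((norm_I_sub_ofReal x).trans h4)
  refine ⟨σ, ?_, ?_, ?_⟩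
  · rw [hd, hd, h01, h12]
  · rw [hd, hd, h12, h20]
  · have hy : 3 * y = x := by
      refine mul_left_cancel₀ hx.ne' ?_
      linear_combination 3 * hxy - h3
    rw [hk, hk, hk, hk, ← hy]
    simp only [kite, Matrix.cons_val]
    push_cast
    ring

/-! ### The dimension count -/

/-- The condition `ha` removes rotations, `ho` and `he` the nontrivial solutions of the two blocks;
only translations remain. -/
theorem kernelVec_kite_trivial {m : Fin 4 → ℝ} (hm : ∀ k, 0 < m k) {x y L : ℝ} (hx : 0 < x)
    (hyx : y < x) (hs : ∀ k, stressVec m L (kite x y) k = 0) {w : Fin 4 → ℂ}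
    (h : ∀ k, kernelVec m L (kite x y) w k = 0) (ha : (w 0).re - (w 1).re = 0)
    (ho : (x - y) / 2 * ((w 0).im + (w 1).im) + y * (w 2).im - x * (w 3).im = 0)
    (he : (x - y) / 2 * ((w 0).re + (w 1).re) + y * (w 2).re - x * (w 3).re = 0) (k : Fin 4) :
    w k = w 0 := by
  have hK := kiteStress_of_stressVec hm hx hyx hs
  obtain ⟨⟨e1, e2⟩, e3, e4, e5⟩ := kernelVec_kite hyx (mass_eq_of_stressVec_kite hm hyx hs) h
    (fun _ => rfl) (fun _ => rfl)
  obtain ⟨o1, o2⟩ := hK.odd_trivial e1 e2 (by linear_combination ho)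
  obtain ⟨t1, t2, t3⟩ := hK.even_trivial e3 e4 e5 (by linear_combination he)
  rw [ha, zero_div, mul_zero, zero_add] at o1 o2
  fin_cases k
  · rfl
  all_goals
    apply Complex.ext
    all_goals
      simp only [Fin.mk_one, Fin.reduceFinMk]
      linarith

theorem kernelVec_kite_not_both {m : Fin 4 → ℝ} (hm : ∀ k, 0 < m k) {x y L : ℝ} (hx : 0 < x)
    (hyx : y < x) (hne : ¬ (x ^ 2 = 3 ∧ x * y = 1)) (hs : ∀ k, stressVec m L (kite x y) k = 0)
    {w w' : Fin 4 → ℂ} (h : ∀ k, kernelVec m L (kite x y) w k = 0)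
    (h' : ∀ k, kernelVec m L (kite x y) w' k = 0)
    (ho : (x - y) / 2 * ((w 0).im + (w 1).im) + y * (w 2).im - x * (w 3).im ≠ 0) :
    (x - y) / 2 * ((w' 0).re + (w' 1).re) + y * (w' 2).re - x * (w' 3).re = 0 := by
  have hK := kiteStress_of_stressVec hm hx hyx hs
  have h01 := mass_eq_of_stressVec_kite hm hyx hs
  obtain ⟨⟨e1, e2⟩, -⟩ := kernelVec_kite hyx h01 h (fun _ => rfl) (fun _ => rfl)
  obtain ⟨-, e3, e4, e5⟩ := kernelVec_kite hyx h01 h' (fun _ => rfl) (fun _ => rfl)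
  have hodd := hK.odd_condition e1 e2 (fun h0 => ho (by linear_combination h0))
  by_contra he
  rcases lt_or_gt_of_ne hK.y_ne_zero with hy | hy
  · exact hK.not_odd_of_neg hy hodd
  · obtain ⟨s1, s2, s3, s4⟩ := hK.concave_signs hy
    exact hK.not_odd_and_even_of_pos hy hne hodd
      (hK.even_condition e3 e4 e5 (by linarith) (by linarith)
        (fun h0 => he (by linear_combination h0)))

/-- The displacement of the `k`-th particle of a kite, in the frame of the kite. -/
def frameCoord (m : Fin 4 → ℝ) (σ : Equiv.Perm (Fin 4)) (ω : ℂ) (k : Fin 4) :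
    centeredSpace m →ₗ[ℝ] ℂ :=
  LinearMap.mulLeft ℝ ω⁻¹ ∘ₗ LinearMap.proj (σ k) ∘ₗ (centeredSpace m).subtype

/-- The mass scalar product with a configuration as a linear form. -/
def massInnerForm (m : Fin 4 → ℝ) (x : centeredSpace m) : centeredSpace m →ₗ[ℝ] ℝ where
  toFun u := massInner m x.1 u.1
  map_add' u v := by
    simp only [massInner, ← Finset.sum_add_distrib]
    exact Finset.sum_congr rfl fun j _ => by
      rw [Submodule.coe_add, Pi.add_apply, inner_add_right, mul_add]
  map_smul' c u := by
    simp only [massInner, RingHom.id_apply, smul_eq_mul, Finset.mul_sum]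
    exact Finset.sum_congr rfl fun j _ => by
      rw [Submodule.coe_smul, Pi.smul_apply, real_inner_smul_right]
      ring

/-- The linear form `(x - y) (z₀ + z₁) / 2 + y z₂ - x z₃` applied to one coordinate of each
displacement. -/
def obliqueForm {V : Type*} [AddCommGroup V] [Module ℝ V] (x y : ℝ) (z : Fin 4 → V →ₗ[ℝ] ℝ) :
    V →ₗ[ℝ] ℝ :=
  ((x - y) / 2) • (z 0 + z 1) + y • z 2 - x • z 3

theorem finrank_le_three_of_forms {V : Type*} [AddCommGroup V] [Module ℝ V] (K : Submodule ℝ V)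
    (f g h : V →ₗ[ℝ] ℝ) (hK : ∀ u ∈ K, f u = 0 → g u = 0 → h u = 0 → u = 0) :
    Module.finrank ℝ K ≤ 3 := by
  have hinj : Function.Injective ((f.prod (g.prod h)).domRestrict K) := by
    rw [← LinearMap.ker_eq_bot, LinearMap.ker_eq_bot']
    intro u hu
    have hu' : (f u.1, g u.1, h u.1) = 0 := hu
    simp only [Prod.mk_eq_zero] at hu'
    exact Subtype.ext (hK u.1 u.2 hu'.1 hu'.2.1 hu'.2.2)
  have := LinearMap.finrank_le_finrank_of_injective hinj
  simpa using this

theorem finrank_hessianKer_le_three {m : Fin 4 → ℝ} (hm : ∀ k, 0 < m k) {lam : ℝ}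
    {r : centeredSpace m} (hr : CollisionFree r.1) (hc : IsCentralWith m lam r.1)
    (hkite : IsKite r.1) (hequi : ¬ IsEquilateral r.1) (h0 : r.1 ≠ 0) :
    Module.finrank ℝ (hessianKer m r) ≤ 3 := by
  obtain ⟨σ, c, ω, x, y, hω, hx, hyx, hk⟩ := hkite.exists_similar_pos hr
  have hne : ¬ (x ^ 2 = 3 ∧ x * y = 1) := fun h =>
    hequi (isEquilateral_of_similar hx hk h.1 h.2)
  have hm' : ∀ k, 0 < (m ∘ σ) k := fun k => hm (σ k)
  set E := frameCoord m σ ω with hE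
  set L := (lam / ∑ j, m j) * ‖ω‖ ^ 3 with hL
  have hEu : ∀ (u : centeredSpace m) (k), u.1 (σ k) = ω * E k u := fun u k =>
    (mul_inv_cancel_left₀ hω _).symm
  have hs : ∀ k, stressVec (m ∘ σ) L (kite x y) k = 0 := fun k =>
    stressVec_similar σ hω hk (hc.stressVec_eq_zero hm (σ k))
  have hker : ∀ u ∈ hessianKer m r, massInnerForm m r u = 0 →
      ∀ k, kernelVec (m ∘ σ) L (kite x y) (fun j => E j u) k = 0 := by
    intro u hu hru k
    exact kernelVec_similar σ hω hk (hEu u)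
      (kernelVec_eq_zero hm hru ((hc.mem_hessianKer_iff hm hr h0 u).mp hu (σ k)))
  set fa : centeredSpace m →ₗ[ℝ] ℝ := Complex.reLm ∘ₗ (E 0 - E 1) with hfa
  set fo := obliqueForm x y fun k => Complex.imLm ∘ₗ E k with hfo
  set fe := obliqueForm x y fun k => Complex.reLm ∘ₗ E k with hfe
  have htriv : ∀ u ∈ hessianKer m r, massInnerForm m r u = 0 → fa u = 0 → fo u = 0 → fe u = 0 →
      u = 0 := by
    intro u hu hru ha ho he
    have hall := kernelVec_kite_trivial hm' hx hyx hs (hker u hu hru) ha ho he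
    -- A translation with center of mass at the origin is zero.
    have hconst : ∀ j, u.1 j = ω * E 0 u := by
      intro j
      rw [← hall (σ.symm j), ← hEu, Equiv.apply_symm_apply]
    have hsum := sum_mass_smul_eq_zero u
    simp only [hconst, ← Finset.sum_smul] at hsum
    have hM : ∑ k, m k ≠ 0 := (Finset.sum_pos (fun k _ => hm k) ⟨0, Finset.mem_univ 0⟩).ne'
    have hz := (smul_eq_zero.mp hsum).resolve_left hM
    ext j
    rw [hconst, hz]
    rfl
  -- If the antisymmetric block is trivial, `fe` serves as the third form. Otherwise the symmetric
  -- block is trivial and `fo` serves.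
  by_cases ho : ∀ u ∈ hessianKer m r, massInnerForm m r u = 0 → fo u = 0
  · exact finrank_le_three_of_forms _ (massInnerForm m r) fa fe fun u hu hru ha he =>
      htriv u hu hru ha (ho u hu hru) he
  · push Not at ho
    obtain ⟨w, hw, hrw, how⟩ := ho
    exact finrank_le_three_of_forms _ (massInnerForm m r) fa fo fun u hu hru ha hou =>
      htriv u hu hru ha hou
        (kernelVec_kite_not_both hm' hx hyx hne hs (hker w hw hrw) (hker u hu hru) how)

end NBody

end

theorem theoremB2 (m : Fin 4 → ℝ) (hm : ∀ k, 0 < m k) (r : NBody.centeredSpace m)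
    (hr : NBody.IsCentralConfiguration m r) (hkite : NBody.IsKite r.1)
    (hequi : ¬ NBody.IsEquilateral r.1) (hdeg : ¬ NBody.IsNondegenerate m r) :
    NBody.HasDegreeOfDegeneracy m r 1 := by
  obtain ⟨hcf, lam, hlam⟩ := hr
  have h0 : r.1 ≠ 0 := fun h0 => hcf 0 1 (by decide) (by rw [h0]; rfl)
  have hc : NBody.IsCentralWith m lam r.1 := hlam
  exact le_antisymm (NBody.finrank_hessianKer_le_three hm hcf hc hkite hequi h0)
    (hc.three_le_finrank hm hcf h0 hdeg)
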